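/- Let $n\ge 2$, $0<\alpha\le 1$, and let $\Omega\subset\mathbb R^n$ be a H\"older-$\alpha$ domain, i.e. a bounded, nonempty, connected open set such that every $\xi\in\partial\Omega$ has an open neighbourhood $U$ for which, in a suitable orthonormal coordinate system $x=(x',x_n)$, $x'\in\mathbb R^{n-1}$, $x_n\in\mathbb R$, one has $\Omega\cap U=\{x\in U: x_n<\varphi(x')\}$ for some function $\varphi:\mathbb R^{n-1}\to\mathbb R$ with $|\varphi(u)-\varphi(v)|\le K|u-v|^\alpha$ for all $u,v$. Write $d(x)=\operatorname{dist}(x,\partial\Omega)$ and $\delta(x,z)=\min\{d(x),d(z)\}$. Let $0<s<1$, $1<p\le q<\infty$, let $b\in\mathbb R$ satisfy $$b\le p(s-n)+p(n-1+\alpha)\Big(1+\frac1q-\frac1p\Big),$$ and assume additionally that $q\le \frac{np}{n-sp}$ if $p<\frac ns$. Then there is a constant $C>0$, independent of $f$, such that for every $f\in C^\infty(\Omega)$ $$\inf_{c\in\mathbb R}\|f-c\|_{L^q(\Omega)}\le C\left\{\int_\Omega\int_{|x-z|\le d(x)/2}\frac{|f(z)-f(x)|^p}{|z-x|^{n+sp}}\,\delta(x,z)^b\,dz\,dx\right\}^{1/p},$$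 both sides being understood as elements of $[0,\infty]$ (so if the right-hand side is finite, so is the left-hand side). -/

import Mathlib

open scoped NNReal ENNReal ContDiff
open MeasureTheory

/-- `d(x) = dist(x, ∂Ω)`. -/
noncomputable def bdryDist {n : ℕ} (Ω : Set (EuclideanSpace ℝ (Fin n)))
    (x : EuclideanSpace ℝ (Fin n)) : ℝ :=
  Metric.infDist x (frontier Ω)

/-- `δ(x, z) = min {d(x), d(z)}`. -/
noncomputable def minBdryDist {n : ℕ} (Ω : Set (EuclideanSpace ℝ (Fin n)))
    (x z : EuclideanSpace ℝ (Fin n)) : ℝ :=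
  min (bdryDist Ω x) (bdryDist Ω z)

/-- A bounded domain (nonempty connected open set) `Ω ⊆ ℝⁿ` is a Hölder-`α` domain if near every
boundary point `ξ` it is, in a suitable orthonormal coordinate system `x ↦ (x', xₙ) = T x`,
the hypograph `{xₙ < φ(x')}` of a Hölder-`α` function `φ`. The open sets `U` belonging to finitely
many boundary points cover the compact boundary. -/
structure IsHolderDomain {n : ℕ} (α : ℝ≥0) (Ω : Set (EuclideanSpace ℝ (Fin n))) : Prop where
  isOpen : IsOpen Ω
  isConnected : IsConnected Ω
  isBounded : Bornology.IsBounded Ω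
  hypograph : ∀ ξ ∈ frontier Ω, ∃ U : Set (EuclideanSpace ℝ (Fin n)), IsOpen U ∧ ξ ∈ U ∧
    ∃ (T : EuclideanSpace ℝ (Fin n) ≃ₗᵢ[ℝ] WithLp 2 (EuclideanSpace ℝ (Fin (n - 1)) × ℝ))
      (φ : EuclideanSpace ℝ (Fin (n - 1)) → ℝ) (K : ℝ≥0),
      HolderWith K α φ ∧ Ω ∩ U = {x | (T x).snd < φ (T x).fst} ∩ U

/-- The weighted fractional energy
`∫_Ω ∫_{|x-z| ≤ d(x)/2} |f(z) - f(x)|^p / |z - x|^(n+sp) δ(x,z)^b dz dx`, with values in `[0, ∞]`.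
For `x ∈ Ω` the closed ball of radius `d(x)/2` about `x` lies in `Ω`, and `δ > 0` there. -/
noncomputable def fracEnergy {n : ℕ} (Ω : Set (EuclideanSpace ℝ (Fin n))) (s p b : ℝ)
    (f : EuclideanSpace ℝ (Fin n) → ℝ) : ℝ≥0∞ :=
  ∫⁻ x in Ω, ∫⁻ z in {z | dist x z ≤ bdryDist Ω x / 2},
    ENNReal.ofReal (|f z - f x| ^ p / ‖z - x‖ ^ ((n : ℝ) + s * p) * minBdryDist Ω x z ^ b)

/-! ### Jensen inequalities for averages and weighted integrals. -/

section Jensen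

variable {β : Type*} [MeasurableSpace β]

/-! Let `u(x)` be the mean of `f` over the ball about `x` of radius `d(x)/16`, and let `c = u(x₀)`
for a fixed `x₀` in `Ω`. In `f - c = (f - u) + (u - c)` the first term is a local error, and the
second only involves averages over Whitney-type balls.

Local term. A Hedberg-type interpolation (`rpow_le_of_forall_rpow_add_rpow`) balances the fractional
oscillation on a ball of radius `r` against `‖f - c‖_q` and gives `|f - u|^q ≤ C ‖f - c‖_q^(q-p) d^σ
g`, where `g` is the inner integral of the energy and `σ = sp - n + np/q - b`. The condition `q ≤
np/(n - sp)` permits the choice of `r`, and the bound on `b` gives `σ ≥ 0`. Integrated over `Ω`, the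
factor `‖f - c‖_q^(q-p)` is absorbed by the left-hand side.

Term `u - c`. On compact subsets of `Ω`, averages over neighbouring balls are chained together. Near
the boundary, `u(y)` is compared with `u` at the point below `y` at twice the depth under the graph.
The chain of balls along this vertical segment becomes a line integral, in which the Hölder
condition `depth ≤ K d^α` is used through Jensen with weight `d^(-α)`. Fubini turns this into an
integral of `g` against `d(x)^(-ν)` over those `x` whose shadow contains `y`. A shadow has volume of
order `d^(n-1+α)`, so with `ν q/p = n - 1 + α` this operator maps `L¹` to `L^(q/p)`; the bound on
`b` makes the remaining power of `d` nonnegative. Depth doubling has Jacobian 2, so the term at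
double depth returns with the factor `2^(-1/q) < 1`, up to a part over a compact set, and is
absorbed.

Both absorptions need finite quantities, so everything is first proved for bounded measurable `f`;
truncation and Fatou's lemma give the general case. Of the smoothness of `f`, only continuity
enters. -/

theorem lintegral_rpow_le_measure_univ_mul {μ : Measure β} {k : β → ℝ≥0∞} (hk : AEMeasurable k μ)
    {r : ℝ} (hr : 1 ≤ r) :
    (∫⁻ x, k x ∂μ) ^ r ≤ μ Set.univ ^ (r - 1) * ∫⁻ x, k x ^ r ∂μ := by
  have hr0 : 0 < r := by linarith
  have h := eLpNorm'_le_eLpNorm'_mul_rpow_measure_univ (p := 1) (q := r) one_pos hr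
    hk.aestronglyMeasurable
  simp only [eLpNorm', enorm_eq_self, ENNReal.rpow_one, div_one] at h
  calc (∫⁻ x, k x ∂μ) ^ r
      ≤ ((∫⁻ x, k x ^ r ∂μ) ^ (1 / r) * μ Set.univ ^ (1 - 1 / r)) ^ r :=
        ENNReal.rpow_le_rpow h hr0.le
    _ = μ Set.univ ^ (r - 1) * ∫⁻ x, k x ^ r ∂μ := by
        rw [ENNReal.mul_rpow_of_nonneg _ _ hr0.le, ← ENNReal.rpow_mul, ← ENNReal.rpow_mul,
          one_div_mul_cancel hr0.ne', ENNReal.rpow_one, mul_comm]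
        congr 2
        field_simp

/-- This is Jensen for the measure `w dμ`. It serves twice: with `w = d^(-α)` along a vertical
segment, and with `w` the energy density in the shadow operator. -/
theorem lintegral_mul_rpow_le {μ : Measure β} {w k : β → ℝ≥0∞} (hw : Measurable w)
    (hk : Measurable k) {r : ℝ} (hr : 1 ≤ r) :
    (∫⁻ x, w x * k x ∂μ) ^ r ≤ (∫⁻ x, w x ∂μ) ^ (r - 1) * ∫⁻ x, w x * k x ^ r ∂μ := by
  have h := lintegral_rpow_le_measure_univ_mul (μ := μ.withDensity w) hk.aemeasurable hr
  rw [lintegral_withDensity_eq_lintegral_mul _ hw hk,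
    lintegral_withDensity_eq_lintegral_mul _ hw (hk.pow_const r),
    withDensity_apply _ MeasurableSet.univ, Measure.restrict_univ] at h
  exact h

theorem enorm_integral_sub_rpow_le {μ : Measure β} [IsProbabilityMeasure μ] {f : β → ℝ}
    (hf : Integrable f μ) (a : ℝ) {p : ℝ} (hp : 1 ≤ p) :
    ‖(∫ x, f x ∂μ) - a‖ₑ ^ p ≤ ∫⁻ x, ‖f x - a‖ₑ ^ p ∂μ := by
  have h1 : (∫ x, f x ∂μ) - a = ∫ x, (f x - a) ∂μ := by
    rw [integral_sub hf (integrable_const a)]; simp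
  rw [h1]
  calc ‖∫ x, (f x - a) ∂μ‖ₑ ^ p ≤ (∫⁻ x, ‖f x - a‖ₑ ∂μ) ^ p :=
        ENNReal.rpow_le_rpow (enorm_integral_le_lintegral_enorm _) (by linarith)
    _ ≤ μ Set.univ ^ (p - 1) * ∫⁻ x, ‖f x - a‖ₑ ^ p ∂μ :=
        lintegral_rpow_le_measure_univ_mul
          (hf.aestronglyMeasurable.sub aestronglyMeasurable_const).enorm hp
    _ = _ := by simp

theorem enorm_setAverage_sub_rpow_le {μ : Measure β} {S : Set β} (h0 : μ S ≠ 0) (h1 : μ S ≠ ⊤)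
    {f : β → ℝ} (hf : IntegrableOn f S μ) (a : ℝ) {p : ℝ} (hp : 1 ≤ p) :
    ‖(⨍ x in S, f x ∂μ) - a‖ₑ ^ p ≤ (μ S)⁻¹ * ∫⁻ x in S, ‖f x - a‖ₑ ^ p ∂μ := by
  have : IsProbabilityMeasure ((μ S)⁻¹ • μ.restrict S) := by
    constructor
    simpa using ENNReal.inv_mul_cancel h0 h1
  have h := enorm_integral_sub_rpow_le (μ := (μ S)⁻¹ • μ.restrict S)
    (hf.smul_measure (ENNReal.inv_ne_top.2 h0)) a hp
  rw [lintegral_smul_measure] at h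
  simpa [average] using h

theorem enorm_setAverage_sub_setAverage_rpow_le {μ : Measure β} {S S' : Set β} (h0 : μ S ≠ 0)
    (h1 : μ S ≠ ⊤) (h0' : μ S' ≠ 0) (h1' : μ S' ≠ ⊤) {f : β → ℝ} (hf : IntegrableOn f S μ)
    (hf' : IntegrableOn f S' μ) {p : ℝ} (hp : 1 ≤ p) :
    ‖(⨍ x in S, f x ∂μ) - ⨍ x in S', f x ∂μ‖ₑ ^ p ≤
      (μ S)⁻¹ * ((μ S')⁻¹ * ∫⁻ x in S, ∫⁻ z in S', ‖f z - f x‖ₑ ^ p ∂μ ∂μ) := by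
  refine (enorm_setAverage_sub_rpow_le h0 h1 hf _ hp).trans ?_
  gcongr
  rw [← lintegral_const_mul' _ _ (ENNReal.inv_ne_top.2 h0')]
  refine lintegral_mono fun x => ?_
  dsimp only
  rw [← enorm_neg, neg_sub]
  exact enorm_setAverage_sub_rpow_le h0' h1' hf' _ hp

end Jensen

/-! ### Balls and the frontier. -/

section Topology

variable {E : Type*} [NormedAddCommGroup E] [NormedSpace ℝ E]

/-- Off its frontier, the space splits into two disjoint open sets, the interior and the exterior of
`t`; a connected set lies in one of them. -/
theorem IsPreconnected.subset_of_disjoint_frontier {X : Type*} [TopologicalSpace X] {s t : Set X}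
    (hs : IsPreconnected s) (hst : (s ∩ t).Nonempty) (h : Disjoint s (frontier t)) : s ⊆ t := by
  intro x hx
  by_contra hxt
  have h2 := isPreconnected_iff_subset_of_disjoint.1 hs (interior t) (closure t)ᶜ isOpen_interior
    isClosed_closure.isOpen_compl
  have h3 : s ⊆ interior t ∪ (closure t)ᶜ := by
    intro y hy
    by_cases hyc : y ∈ closure t
    · left
      by_contra hyi
      exact Set.disjoint_left.1 h hy ⟨hyc, hyi⟩
    · exact Or.inr hyc
  have h4 : s ∩ (interior t ∩ (closure t)ᶜ) = ∅ := by
    ext y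
    simp only [Set.mem_inter_iff, Set.mem_compl_iff, Set.mem_empty_iff_false, iff_false]
    rintro ⟨-, hy1, hy2⟩
    exact hy2 (interior_subset_closure hy1)
  obtain h5 | h5 := h2 h3 h4
  · exact hxt (interior_subset (h5 hx))
  · obtain ⟨y, hy, hyt⟩ := hst
    exact h5 hy (subset_closure hyt)

theorem ball_infDist_frontier_subset {Ω : Set E} {x : E} (hx : x ∈ Ω) :
    Metric.ball x (Metric.infDist x (frontier Ω)) ⊆ Ω := by
  -- The first case includes an empty frontier, where `infDist` takes the default value 0 and the
  -- ball is empty.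
  obtain h | h := le_or_gt (Metric.infDist x (frontier Ω)) 0
  · rw [Metric.ball_eq_empty.2 h]
    exact Set.empty_subset _
  · refine IsPreconnected.subset_of_disjoint_frontier (convex_ball x _).isPreconnected
      ⟨x, Metric.mem_ball_self h, hx⟩ ?_
    rw [Set.disjoint_left]
    intro y hy hyf
    have := Metric.infDist_le_dist_of_mem (x := x) hyf
    rw [Metric.mem_ball, dist_comm] at hy
    linarith

theorem frontier_nonempty_of_isBounded [Nontrivial E] {Ω : Set E} (hne : Ω.Nonempty)
    (hb : Bornology.IsBounded Ω) : (frontier Ω).Nonempty := by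
  by_contra hf
  rw [Set.not_nonempty_iff_eq_empty] at hf
  have h := IsPreconnected.subset_of_disjoint_frontier (t := Ω)
    (isPreconnected_univ (α := E)) (by simpa using hne) (by simp [hf])
  exact NormedSpace.unbounded_univ ℝ E (hb.subset h)

end Topology

/-- Two quantities within a factor 2 of each other have comparable powers whatever the sign of the
exponent, which matters because neither `b` nor the derived exponents have a fixed sign. -/
theorem Real.rpow_le_two_rpow_abs_mul {x y : ℝ} (hx : 0 < x) (hy : 0 < y) (hxy : x ≤ 2 * y)
    (hyx : y ≤ 2 * x) (b : ℝ) : x ^ b ≤ 2 ^ |b| * y ^ b := by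
  obtain hb | hb := le_total 0 b
  · rw [abs_of_nonneg hb, ← Real.mul_rpow (by norm_num) hy.le]
    exact Real.rpow_le_rpow hx.le hxy hb
  · rw [abs_of_nonpos hb, Real.rpow_neg (by norm_num), ← div_eq_inv_mul,
      ← Real.div_rpow hy.le (by norm_num)]
    exact Real.rpow_le_rpow_of_nonpos (by positivity) (by linarith) hb

/-! ### Energy density and ball averages. -/

section Domain

variable {n : ℕ} {Ω : Set (EuclideanSpace ℝ (Fin n))} {s p b : ℝ}
  {f : EuclideanSpace ℝ (Fin n) → ℝ} {x : EuclideanSpace ℝ (Fin n)}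

/-- The inner integral of `fracEnergy`. -/
noncomputable def energyDensity (Ω : Set (EuclideanSpace ℝ (Fin n))) (s p b : ℝ)
    (f : EuclideanSpace ℝ (Fin n) → ℝ) (x : EuclideanSpace ℝ (Fin n)) : ℝ≥0∞ :=
  ∫⁻ z in {z | dist x z ≤ bdryDist Ω x / 2},
    ENNReal.ofReal (|f z - f x| ^ p / ‖z - x‖ ^ ((n : ℝ) + s * p) * minBdryDist Ω x z ^ b)

/-- The average of `f` over the ball about `x` of radius `d(x) / 16`. -/
noncomputable def ballAvg (Ω : Set (EuclideanSpace ℝ (Fin n)))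
    (f : EuclideanSpace ℝ (Fin n) → ℝ) (x : EuclideanSpace ℝ (Fin n)) : ℝ :=
  ⨍ z in Metric.ball x (bdryDist Ω x / 16), f z

theorem continuous_bdryDist (Ω : Set (EuclideanSpace ℝ (Fin n))) : Continuous (bdryDist Ω) :=
  Metric.continuous_infDist_pt _

theorem bdryDist_le_add_dist (x z : EuclideanSpace ℝ (Fin n)) :
    bdryDist Ω x ≤ bdryDist Ω z + dist x z :=
  Metric.infDist_le_infDist_add_dist

theorem bdryDist_pos (hΩ : IsOpen Ω) (hfr : (frontier Ω).Nonempty) (hx : x ∈ Ω) :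
    0 < bdryDist Ω x := by
  refine (isClosed_frontier.notMem_iff_infDist_pos hfr).1 fun h => ?_
  rw [hΩ.frontier_eq] at h
  exact h.2 hx

/-- For `|z - x| ≤ r ≤ d(x)/2` the kernel is at least `r^(-(n+sp))` and `δ(x,z)` is within a factor
2 of `d(x)`, so kernel and weight can be replaced by constants. -/
theorem setLIntegral_enorm_sub_rpow_le (hs : 0 < s) (hp : 0 < p) {r : ℝ}
    (hr : 0 < r) (hrd : r ≤ bdryDist Ω x / 2) {S : Set (EuclideanSpace ℝ (Fin n))}
    (hS : S ⊆ Metric.closedBall x r) :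
    ∫⁻ z in S, ‖f z - f x‖ₑ ^ p ≤
      ENNReal.ofReal (2 ^ |b| * r ^ ((n : ℝ) + s * p) * bdryDist Ω x ^ (-b)) *
        energyDensity Ω s p b f x := by
  set d := bdryDist Ω x with hd
  have hd0 : 0 < d := by linarith
  calc ∫⁻ z in S, ‖f z - f x‖ₑ ^ p ≤ ∫⁻ z in Metric.closedBall x r, ‖f z - f x‖ₑ ^ p :=
        lintegral_mono_set hS
    _ ≤ ∫⁻ z in Metric.closedBall x r,
          ENNReal.ofReal (2 ^ |b| * r ^ ((n : ℝ) + s * p) * d ^ (-b)) *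
          ENNReal.ofReal (|f z - f x| ^ p / ‖z - x‖ ^ ((n : ℝ) + s * p) *
            minBdryDist Ω x z ^ b) := by
        refine setLIntegral_mono' Metric.isClosed_closedBall.measurableSet fun z hz => ?_
        rw [← ENNReal.ofReal_mul (by positivity), Real.enorm_eq_ofReal_abs,
          ENNReal.ofReal_rpow_of_nonneg (abs_nonneg _) hp.le]
        refine ENNReal.ofReal_le_ofReal ?_
        rw [Metric.mem_closedBall] at hz
        obtain rfl | hzx := eq_or_ne z x
        · simp [Real.zero_rpow hp.ne']
        have hN : 0 < ‖z - x‖ := norm_pos_iff.2 (sub_ne_zero.2 hzx)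
        have hNr : ‖z - x‖ ^ ((n : ℝ) + s * p) ≤ r ^ ((n : ℝ) + s * p) := by
          refine Real.rpow_le_rpow hN.le ?_ (by positivity)
          rwa [← dist_eq_norm]
        have h1 : d ≤ bdryDist Ω z + dist x z := bdryDist_le_add_dist x z
        rw [dist_comm] at h1
        have hδ1 : d ≤ 2 * minBdryDist Ω x z := by
          unfold minBdryDist
          rw [← hd]
          obtain h | h := le_total d (bdryDist Ω z)
          · rw [min_eq_left h]; linarith
          · rw [min_eq_right h]; linarith
        have hδ2 : minBdryDist Ω x z ≤ d := min_le_left _ _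
        have hδ0 : 0 < minBdryDist Ω x z := by linarith
        have h2 := Real.rpow_le_two_rpow_abs_mul hd0 hδ0 hδ1 (by linarith) b
        have hA : 0 ≤ |f z - f x| ^ p := by positivity
        have hM : 0 < ‖z - x‖ ^ ((n : ℝ) + s * p) := by positivity
        have hd1 : 0 < d ^ b := by positivity
        calc |f z - f x| ^ p
            = (|f z - f x| ^ p / ‖z - x‖ ^ ((n : ℝ) + s * p)) *
              (‖z - x‖ ^ ((n : ℝ) + s * p) * (d ^ b * d ^ (-b))) := by
              rw [← Real.rpow_add hd0]
              simp
              field_simp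
          _ ≤ (|f z - f x| ^ p / ‖z - x‖ ^ ((n : ℝ) + s * p)) *
              (r ^ ((n : ℝ) + s * p) * ((2 ^ |b| * minBdryDist Ω x z ^ b) * d ^ (-b))) := by
              gcongr
          _ = _ := by ring
    _ = ENNReal.ofReal (2 ^ |b| * r ^ ((n : ℝ) + s * p) * d ^ (-b)) *
        ∫⁻ z in Metric.closedBall x r,
          ENNReal.ofReal (|f z - f x| ^ p / ‖z - x‖ ^ ((n : ℝ) + s * p) *
            minBdryDist Ω x z ^ b) := lintegral_const_mul' _ _ ENNReal.ofReal_ne_top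
    _ ≤ _ := by
        gcongr
        refine lintegral_mono_set fun z hz => ?_
        rw [Metric.mem_closedBall, dist_comm] at hz
        exact hz.trans hrd

theorem volume_ball_eq (x : EuclideanSpace ℝ (Fin n)) {r : ℝ} (hr : 0 < r) :
    volume (Metric.ball x r) = ENNReal.ofReal
      (r ^ n * volume.real (Metric.ball (0 : EuclideanSpace ℝ (Fin n)) 1)) := by
  rw [Measure.addHaar_ball_of_pos _ _ hr, ENNReal.ofReal_mul (by positivity),
    ofReal_measureReal measure_ball_lt_top.ne]
  simp

theorem volume_real_unitBall_pos :
    0 < volume.real (Metric.ball (0 : EuclideanSpace ℝ (Fin n)) 1) :=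
  ENNReal.toReal_pos (Metric.measure_ball_pos _ _ one_pos).ne' measure_ball_lt_top.ne

theorem integrableOn_of_abs_le (hf : Measurable f) {N : ℝ} (hN : ∀ x, |f x| ≤ N)
    {S : Set (EuclideanSpace ℝ (Fin n))} (hS : volume S ≠ ⊤) : IntegrableOn f S :=
  Measure.integrableOn_of_bounded hS hf.aestronglyMeasurable
    (Filter.Eventually.of_forall fun x => by simpa using hN x)

/-- Both averaging balls have radius comparable to `d = d(v)` and lie so close to `v` that any two
of their points interact in the energy. The double average then carries `d^(-2n)` from the two
volumes, `d^(n+sp)` from the kernel and `d^(-b)` from the weight. -/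
theorem exists_enorm_ballAvg_sub_ballAvg_le (n : ℕ) {s p : ℝ} (hs : 0 < s) (hp : 1 ≤ p) (b : ℝ) :
    ∃ C : ℝ, 0 < C ∧ ∀ (Ω : Set (EuclideanSpace ℝ (Fin n))) (f : EuclideanSpace ℝ (Fin n) → ℝ),
      Measurable f → (∃ N, ∀ x, |f x| ≤ N) → ∀ v x x' : EuclideanSpace ℝ (Fin n),
      0 < bdryDist Ω v → dist x v ≤ bdryDist Ω v / 16 → dist x' v ≤ bdryDist Ω v / 16 →
      ‖ballAvg Ω f x - ballAvg Ω f x'‖ₑ ^ p ≤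
        ENNReal.ofReal (C * bdryDist Ω v ^ (s * p - n - b)) *
          ∫⁻ w in Metric.ball v (bdryDist Ω v / 4), energyDensity Ω s p b f w := by
  set c := volume.real (Metric.ball (0 : EuclideanSpace ℝ (Fin n)) 1) with hc
  have hc0 : 0 < c := volume_real_unitBall_pos
  refine ⟨(((1 / 32) ^ n * c)⁻¹) ^ 2 * (2 ^ |b| * 2 ^ |(n : ℝ) + s * p| * 2 ^ |-b|), by positivity,
    fun Ω f hf ⟨N, hN⟩ v x x' hv hx hx' => ?_⟩
  set d := bdryDist Ω v with hd
  have key : ∀ y, dist y v ≤ d / 16 →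
      d / 32 ≤ bdryDist Ω y / 16 ∧ bdryDist Ω y / 16 ≤ d * 17 / 256 := by
    intro y hy
    have h1 : d ≤ bdryDist Ω y + dist v y := bdryDist_le_add_dist v y
    have h2 : bdryDist Ω y ≤ d + dist y v := bdryDist_le_add_dist y v
    rw [dist_comm] at h1
    constructor <;> linarith
  have hvol : ∀ y, dist y v ≤ d / 16 → (volume (Metric.ball y (bdryDist Ω y / 16)))⁻¹ ≤
      ENNReal.ofReal (((d / 32) ^ n * c)⁻¹) := by
    intro y hy
    have h1 := (key y hy).1
    rw [volume_ball_eq y (by linarith), ENNReal.ofReal_inv_of_pos (by positivity)]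
    refine ENNReal.inv_le_inv.2 (ENNReal.ofReal_le_ofReal ?_)
    gcongr
  -- `33/256 = 1/16 + 17/256`: distance of the centre from `v` plus the largest possible radius.
  have hbx : Metric.ball x (bdryDist Ω x / 16) ⊆ Metric.ball v (d * 33 / 256) := by
    refine Metric.ball_subset_ball' ?_
    linarith [(key x hx).2]
  have hbx' : Metric.ball x' (bdryDist Ω x' / 16) ⊆ Metric.ball v (d * 33 / 256) := by
    refine Metric.ball_subset_ball' ?_
    linarith [(key x' hx').2]
  have hpx : 0 < bdryDist Ω x / 16 := by linarith [(key x hx).1]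
  have hpx' : 0 < bdryDist Ω x' / 16 := by linarith [(key x' hx').1]
  have hJ := enorm_setAverage_sub_setAverage_rpow_le (μ := volume)
    (Metric.measure_ball_pos volume x hpx).ne' measure_ball_lt_top.ne
    (Metric.measure_ball_pos volume x' hpx').ne' measure_ball_lt_top.ne
    (integrableOn_of_abs_le hf hN measure_ball_lt_top.ne)
    (integrableOn_of_abs_le hf hN measure_ball_lt_top.ne) hp
  have hI : ∫⁻ w in Metric.ball x (bdryDist Ω x / 16), ∫⁻ z in Metric.ball x' (bdryDist Ω x' / 16),
      ‖f z - f w‖ₑ ^ p ≤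
      ENNReal.ofReal (2 ^ |b| * (2 ^ |(n : ℝ) + s * p| * d ^ ((n : ℝ) + s * p)) *
        (2 ^ |-b| * d ^ (-b))) *
      ∫⁻ w in Metric.ball v (d / 4), energyDensity Ω s p b f w := by
    rw [← lintegral_const_mul' _ _ ENNReal.ofReal_ne_top]
    refine le_trans ?_ (lintegral_mono_set
      (hbx.trans (Metric.ball_subset_ball (by linarith : d * 33 / 256 ≤ d / 4))))
    refine setLIntegral_mono' Metric.isOpen_ball.measurableSet fun w hw => ?_
    have hw' := hbx hw
    rw [Metric.mem_ball] at hw'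
    have h1 : d ≤ bdryDist Ω w + dist v w := bdryDist_le_add_dist v w
    have h2 : bdryDist Ω w ≤ d + dist w v := bdryDist_le_add_dist w v
    rw [dist_comm] at h1
    have hw0 : 0 < bdryDist Ω w := by linarith
    refine (setLIntegral_enorm_sub_rpow_le (b := b) hs (by linarith) (half_pos hw0) le_rfl
      fun z hz => ?_).trans ?_
    · have hz' := hbx' hz
      rw [Metric.mem_ball] at hz'
      rw [Metric.mem_closedBall]
      have := dist_triangle_right z w v
      linarith
    · gcongr
      · refine le_trans ?_ (Real.rpow_le_two_rpow_abs_mul hw0 hv (by linarith) (by linarith) _)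
        gcongr
        linarith
      · exact Real.rpow_le_two_rpow_abs_mul hw0 hv (by linarith) (by linarith) _
  refine hJ.trans ?_
  calc _ ≤ ENNReal.ofReal (((d / 32) ^ n * c)⁻¹) * (ENNReal.ofReal (((d / 32) ^ n * c)⁻¹) *
        (ENNReal.ofReal (2 ^ |b| * (2 ^ |(n : ℝ) + s * p| * d ^ ((n : ℝ) + s * p)) *
        (2 ^ |-b| * d ^ (-b))) *
      ∫⁻ w in Metric.ball v (d / 4), energyDensity Ω s p b f w)) := by
        gcongr
        · exact hvol x hx
        · exact hvol x' hx'
    _ = _ := by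
        rw [← mul_assoc, ← mul_assoc, ← ENNReal.ofReal_mul (by positivity),
          ← ENNReal.ofReal_mul (by positivity)]
        congr 2
        have h1 : d ^ (s * p - n - b) = d ^ ((n : ℝ) + s * p) * d ^ (-b) * (d ^ n)⁻¹ * (d ^ n)⁻¹ := by
          rw [← Real.rpow_natCast, ← Real.rpow_neg hv.le, ← Real.rpow_add hv, ← Real.rpow_add hv,
            ← Real.rpow_add hv]
          congr 1
          ring
        rw [h1]
        have h3 : (d / 32) ^ n = d ^ n * (1 / 32) ^ n := by rw [← mul_pow]; ring
        rw [h3]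
        simp only [mul_inv]
        ring

theorem energyDensity_measurable (hf : Measurable f) : Measurable (energyDensity Ω s p b f) := by
  have h : energyDensity Ω s p b f = fun x => ∫⁻ z, Set.indicator
      {y : EuclideanSpace ℝ (Fin n) × EuclideanSpace ℝ (Fin n) | dist y.1 y.2 ≤ bdryDist Ω y.1 / 2}
      (fun y => ENNReal.ofReal (|f y.2 - f y.1| ^ p / ‖y.2 - y.1‖ ^ ((n : ℝ) + s * p) *
        minBdryDist Ω y.1 y.2 ^ b)) (x, z) := by
    funext x
    unfold energyDensity
    rw [← lintegral_indicator]
    · rfl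
    · exact (isClosed_le (by fun_prop) (by fun_prop)).measurableSet
  rw [h]
  refine Measurable.lintegral_prod_right' (f := Set.indicator _ _) (Measurable.indicator ?_ ?_)
  · have hd := (continuous_bdryDist Ω).measurable
    unfold minBdryDist
    fun_prop
  · have hd := (continuous_bdryDist Ω)
    exact (isClosed_le (by fun_prop) (by fun_prop)).measurableSet

theorem ballAvg_measurable (hf : Measurable f) : Measurable (ballAvg Ω f) := by
  have hd := (continuous_bdryDist Ω)
  have hset : MeasurableSet {y : EuclideanSpace ℝ (Fin n) × EuclideanSpace ℝ (Fin n) |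
      dist y.2 y.1 < bdryDist Ω y.1 / 16} :=
    (isOpen_lt (by fun_prop) (by fun_prop)).measurableSet
  have h : ballAvg Ω f = fun x => (∫⁻ z, Set.indicator
      {y : EuclideanSpace ℝ (Fin n) × EuclideanSpace ℝ (Fin n) | dist y.2 y.1 < bdryDist Ω y.1 / 16}
      (fun _ => 1) (x, z)).toReal⁻¹ * ∫ z, Set.indicator
      {y : EuclideanSpace ℝ (Fin n) × EuclideanSpace ℝ (Fin n) | dist y.2 y.1 < bdryDist Ω y.1 / 16}
      (fun y => f y.2) (x, z) := by
    funext x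
    unfold ballAvg
    rw [setAverage_eq, smul_eq_mul, ← integral_indicator Metric.isOpen_ball.measurableSet]
    congr 2
    rw [Measure.real, ← setLIntegral_one, ← lintegral_indicator Metric.isOpen_ball.measurableSet]
    rfl
  rw [h]
  refine Measurable.mul (Measurable.inv (Measurable.ennreal_toReal ?_)) ?_
  · exact Measurable.lintegral_prod_right' (f := Set.indicator _ _)
      (Measurable.indicator measurable_const hset)
  · exact (StronglyMeasurable.integral_prod_right' (f := Set.indicator _ _)
      (Measurable.indicator (by fun_prop) hset).stronglyMeasurable).measurable

theorem abs_ballAvg_le {N : ℝ} (hN : ∀ x, |f x| ≤ N)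
    (hx : 0 < bdryDist Ω x) : |ballAvg Ω f x| ≤ N := by
  unfold ballAvg
  have h0 := Metric.measure_ball_pos volume x (show 0 < bdryDist Ω x / 16 by linarith)
  have h1 : volume (Metric.ball x (bdryDist Ω x / 16)) ≠ ⊤ := measure_ball_lt_top.ne
  rw [setAverage_eq, smul_eq_mul, abs_mul, abs_inv, abs_of_nonneg measureReal_nonneg]
  have h2 := norm_setIntegral_le_of_norm_le_const (f := f) (C := N) h1.lt_top
    (fun y _ => by simpa using hN y)
  rw [Real.norm_eq_abs] at h2
  have h3 : 0 < volume.real (Metric.ball x (bdryDist Ω x / 16)) := ENNReal.toReal_pos h0.ne' h1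
  rw [inv_mul_le_iff₀ h3]
  linarith

end Domain

/-! ### Comparison of averages on compact subsets of `Ω`. -/

section Interior

variable {n : ℕ} {Ω : Set (EuclideanSpace ℝ (Fin n))} {s p q b : ℝ}
  {f : EuclideanSpace ℝ (Fin n) → ℝ} {x : EuclideanSpace ℝ (Fin n)}

theorem setLIntegral_energyDensity_le_fracEnergy {S : Set (EuclideanSpace ℝ (Fin n))}
    (hS : S ⊆ Ω) : ∫⁻ w in S, energyDensity Ω s p b f w ≤ fracEnergy Ω s p b f :=
  lintegral_mono_set hS

theorem ball_bdryDist_subset (hx : x ∈ Ω) {r : ℝ} (hr : r ≤ bdryDist Ω x) :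
    Metric.ball x r ⊆ Ω :=
  (Metric.ball_subset_ball hr).trans (ball_infDist_frontier_subset hx)

theorem exists_ballAvg_sub_ballAvg_le_of_dist_le (hs : 0 < s) (hp : 1 ≤ p)
    {v : EuclideanSpace ℝ (Fin n)} (hv : v ∈ Ω) (hd : 0 < bdryDist Ω v) :
    ∃ C : ℝ≥0, ∀ f : EuclideanSpace ℝ (Fin n) → ℝ, Measurable f → (∃ N, ∀ x, |f x| ≤ N) →
      ∀ x x', dist x v ≤ bdryDist Ω v / 16 → dist x' v ≤ bdryDist Ω v / 16 →
      ‖ballAvg Ω f x - ballAvg Ω f x'‖ₑ ≤ C * fracEnergy Ω s p b f ^ (1 / p) := by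
  obtain ⟨C, hC, h⟩ := exists_enorm_ballAvg_sub_ballAvg_le n hs hp b
  refine ⟨(C * bdryDist Ω v ^ (s * p - n - b)).toNNReal ^ (1 / p), fun f hf hN x x' hx hx' => ?_⟩
  have h1 := (h Ω f hf hN v x x' hd hx hx').trans (mul_le_mul_right
    (setLIntegral_energyDensity_le_fracEnergy (ball_bdryDist_subset hv (by linarith))) _)
  rw [ENNReal.coe_rpow_of_nonneg _ (by positivity), ← ENNReal.mul_rpow_of_nonneg _ _ (by positivity),
    one_div, ENNReal.le_rpow_inv_iff (by linarith)]
  exact h1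

/-- Comparability of averages at two points, with a constant independent of `f`, is symmetric and
transitive, and each point is comparable to all nearby points; connectedness does the rest. -/
theorem exists_ballAvg_sub_ballAvg_le_of_mem (hs : 0 < s) (hp : 1 ≤ p) (hΩ : IsOpen Ω)
    (hc : IsPreconnected Ω) (hfr : (frontier Ω).Nonempty) {x x' : EuclideanSpace ℝ (Fin n)}
    (hx : x ∈ Ω) (hx' : x' ∈ Ω) :
    ∃ C : ℝ≥0, ∀ f : EuclideanSpace ℝ (Fin n) → ℝ, Measurable f → (∃ N, ∀ x, |f x| ≤ N) →
      ‖ballAvg Ω f x - ballAvg Ω f x'‖ₑ ≤ C * fracEnergy Ω s p b f ^ (1 / p) := by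
  refine hc.induction₂ (fun x x' => ∃ C : ℝ≥0, ∀ f : EuclideanSpace ℝ (Fin n) → ℝ, Measurable f →
    (∃ N, ∀ x, |f x| ≤ N) →
      ‖ballAvg Ω f x - ballAvg Ω f x'‖ₑ ≤ C * fracEnergy Ω s p b f ^ (1 / p)) ?_ ?_ ?_ hx hx'
  · intro v hv
    have hd := bdryDist_pos hΩ hfr hv
    obtain ⟨C, hC⟩ := exists_ballAvg_sub_ballAvg_le_of_dist_le (b := b) hs hp hv hd
    filter_upwards [mem_nhdsWithin_of_mem_nhds (Metric.closedBall_mem_nhds v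
      (show 0 < bdryDist Ω v / 16 by linarith))] with y hy
    exact ⟨C, fun f hf hN => hC f hf hN v y (by simp; linarith) hy⟩
  · rintro x y z - - - ⟨C, hC⟩ ⟨C', hC'⟩
    refine ⟨C + C', fun f hf hN => ?_⟩
    rw [ENNReal.coe_add, add_mul]
    refine le_trans ?_ (add_le_add (hC f hf hN) (hC' f hf hN))
    simp only [← edist_eq_enorm_sub]
    exact edist_triangle _ _ _
  · rintro x y - - ⟨C, hC⟩
    refine ⟨C, fun f hf hN => ?_⟩
    rw [← enorm_neg, neg_sub]
    exact hC f hf hN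

theorem exists_ballAvg_sub_le_of_isCompact (hs : 0 < s) (hp : 1 ≤ p) (hΩ : IsOpen Ω)
    (hc : IsPreconnected Ω) (hfr : (frontier Ω).Nonempty) {x₀ : EuclideanSpace ℝ (Fin n)}
    (hx₀ : x₀ ∈ Ω) {K : Set (EuclideanSpace ℝ (Fin n))} (hK : IsCompact K) (hKΩ : K ⊆ Ω) :
    ∃ C : ℝ≥0, ∀ f : EuclideanSpace ℝ (Fin n) → ℝ, Measurable f → (∃ N, ∀ x, |f x| ≤ N) →
      ∀ x ∈ K, ‖ballAvg Ω f x - ballAvg Ω f x₀‖ₑ ≤ C * fracEnergy Ω s p b f ^ (1 / p) := by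
  refine hK.induction_on (p := fun K => ∃ C : ℝ≥0, ∀ f : EuclideanSpace ℝ (Fin n) → ℝ,
    Measurable f → (∃ N, ∀ x, |f x| ≤ N) →
      ∀ x ∈ K, ‖ballAvg Ω f x - ballAvg Ω f x₀‖ₑ ≤ C * fracEnergy Ω s p b f ^ (1 / p)) ?_ ?_ ?_ ?_
  · exact ⟨0, fun f _ _ x hx => hx.elim⟩
  · rintro S T hST ⟨C, hC⟩
    exact ⟨C, fun f hf hN x hx => hC f hf hN x (hST hx)⟩
  · rintro S T ⟨C, hC⟩ ⟨C', hC'⟩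
    refine ⟨C + C', fun f hf hN x hx => ?_⟩
    rw [ENNReal.coe_add, add_mul]
    obtain hx | hx := hx
    · exact (hC f hf hN x hx).trans le_self_add
    · exact (hC' f hf hN x hx).trans le_add_self
  · intro v hv
    have hd := bdryDist_pos hΩ hfr (hKΩ hv)
    obtain ⟨C, hC⟩ := exists_ballAvg_sub_ballAvg_le_of_dist_le (b := b) hs hp (hKΩ hv) hd
    obtain ⟨C', hC'⟩ := exists_ballAvg_sub_ballAvg_le_of_mem (b := b) hs hp hΩ hc hfr (hKΩ hv) hx₀
    refine ⟨_, mem_nhdsWithin_of_mem_nhds (Metric.closedBall_mem_nhds v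
      (show 0 < bdryDist Ω v / 16 by linarith)), C + C', fun f hf hN y hy => ?_⟩
    rw [ENNReal.coe_add, add_mul]
    refine le_trans ?_ (add_le_add (hC f hf hN y v hy (by simp; linarith)) (hC' f hf hN))
    simp only [← edist_eq_enorm_sub]
    exact edist_triangle _ _ _

end Interior

/-! ### Two scalar inequalities: interpolation and absorption. -/

section Interpolation

/-- Hedberg's trick: choose `r` so that `r^s a` and `r^(-N/q) X` balance, or `r = R` if the
balancing radius exceeds `R`. Nonnegativity of the last exponent lets that surplus power of `r` be
bounded by a power of `R`. -/
theorem rpow_le_of_forall_rpow_add_rpow {w X a R C N s p q : ℝ} (hw : 0 ≤ w) (hX : 0 < X)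
    (ha : 0 ≤ a) (hR : 0 < R) (hC : 0 < C) (hN : 0 ≤ N) (hs : 0 < s) (hp : 0 < p) (hpq : p ≤ q)
    (hκ : 0 ≤ s * p - N + N * p / q) (h1 : w ≤ C * (R ^ s * a))
    (h2 : ∀ r, 0 < r → r ≤ R → w ≤ C * (r ^ s * a + r ^ (-N / q) * X)) :
    w ^ q ≤ (2 * C) ^ q * X ^ (q - p) * a ^ p * R ^ (s * p - N + N * p / q) := by
  have hq : 0 < q := by linarith
  obtain rfl | ha := ha.eq_or_lt
  · have : w = 0 := by simpa using le_antisymm (by simpa using h1) hw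
    rw [this, Real.zero_rpow hq.ne']
    positivity
  set γ := s + N / q with hγ
  have hγ0 : 0 < γ := by positivity
  -- `r₀` is the radius at which the two terms of `h2` are equal.
  obtain ⟨r₀, hr₀, hXr⟩ : ∃ r₀, 0 < r₀ ∧ X = a * r₀ ^ γ := by
    refine ⟨(X / a) ^ (1 / γ), by positivity, ?_⟩
    rw [← Real.rpow_mul (by positivity), one_div_mul_cancel hγ0.ne', Real.rpow_one]
    field_simp
  set ρ := min r₀ R with hρ
  have hρ0 : 0 < ρ := lt_min hr₀ hR
  have hwρ : w ≤ 2 * C * (ρ ^ s * a) := by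
    obtain h | h := le_total r₀ R
    · rw [hρ, min_eq_left h]
      refine (h2 r₀ hr₀ h).trans_eq ?_
      have : r₀ ^ (-N / q) * X = r₀ ^ s * a := by
        rw [hXr, mul_left_comm, ← Real.rpow_add hr₀, mul_comm, hγ]
        congr 2
        ring
      rw [this]
      ring
    · rw [hρ, min_eq_right h]
      refine h1.trans ?_
      have : 0 ≤ C * (R ^ s * a) := by positivity
      linarith
  calc w ^ q ≤ (2 * C * (ρ ^ s * a)) ^ q := Real.rpow_le_rpow hw hwρ hq.le
    _ = (2 * C) ^ q * (a ^ (q - p) * ρ ^ (γ * (q - p))) * a ^ p * ρ ^ (s * p - N + N * p / q) := by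
        rw [Real.mul_rpow (by positivity) (by positivity), Real.mul_rpow (by positivity) ha.le,
          ← Real.rpow_mul hρ0.le]
        have e1 : a ^ q = a ^ (q - p) * a ^ p := by
          rw [← Real.rpow_add ha]; congr 1; ring
        have e2 : ρ ^ (s * q) = ρ ^ (γ * (q - p)) * ρ ^ (s * p - N + N * p / q) := by
          rw [← Real.rpow_add hρ0]; congr 1; rw [hγ]; field_simp; ring
        rw [e1, e2]
        ring
    -- The power `γ (q - p)` of `ρ` is bounded by `r₀`, rebuilding `X`, and the remaining power by
    -- `R`.
    _ ≤ (2 * C) ^ q * (a ^ (q - p) * r₀ ^ (γ * (q - p))) * a ^ p * R ^ (s * p - N + N * p / q) := by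
        have : 0 ≤ γ * (q - p) := mul_nonneg hγ0.le (by linarith)
        gcongr
        · exact min_le_left _ _
        · exact min_le_right _ _
    _ = _ := by
        rw [Real.rpow_mul hr₀.le, ← Real.mul_rpow ha.le (by positivity), ← hXr]

/-- Either `K * N` dominates `Y` and `X ≤ 2 * K * N`, or `X ≤ 2 * Y` and `X ^ (q - p)` cancels from
both sides of the bound for `Y ^ q`. -/
theorem le_mul_of_le_add_of_rpow_le {X Y N K C p q : ℝ} (hX : 0 < X) (hY : 0 ≤ Y) (hN : 0 ≤ N)
    (hK : 0 ≤ K) (hC : 0 ≤ C) (hp : 0 < p) (hpq : p ≤ q) (h1 : X ≤ Y + K * N)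
    (h2 : Y ^ q ≤ C * X ^ (q - p) * N ^ p) : X ≤ (2 * K + (2 ^ q * C) ^ (1 / p)) * N := by
  have hq : 0 < q := by linarith
  rw [add_mul]
  obtain h | h := le_total Y (K * N)
  · have : 0 ≤ (2 ^ q * C) ^ (1 / p) * N := by positivity
    linarith
  · have h3 : X ^ q ≤ 2 ^ q * C * N ^ p * X ^ (q - p) := by
      calc X ^ q ≤ (2 * Y) ^ q := Real.rpow_le_rpow hX.le (by linarith) hq.le
        _ = 2 ^ q * Y ^ q := Real.mul_rpow (by norm_num) hY
        _ ≤ 2 ^ q * (C * X ^ (q - p) * N ^ p) := by gcongr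
        _ = _ := by ring
    have h4 : X ^ p ≤ 2 ^ q * C * N ^ p := by
      have h5 : X ^ q = X ^ p * X ^ (q - p) := by rw [← Real.rpow_add hX]; congr 1; ring
      rw [h5] at h3
      exact le_of_mul_le_mul_right h3 (by positivity)
    have h6 : X ≤ (2 ^ q * C) ^ (1 / p) * N := by
      calc X = (X ^ p) ^ (1 / p) := by
            rw [← Real.rpow_mul hX.le, mul_one_div_cancel hp.ne', Real.rpow_one]
        _ ≤ (2 ^ q * C * N ^ p) ^ (1 / p) := Real.rpow_le_rpow (by positivity) h4 (by positivity)
        _ = _ := by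
            rw [Real.mul_rpow (by positivity) (by positivity), ← Real.rpow_mul hN,
              mul_one_div_cancel hp.ne', Real.rpow_one]
    have : 0 ≤ K * N := by positivity
    linarith

end Interpolation

/-! ### Pointwise bound for `f` minus its local average. -/

section Local

/-- The mean over a ball of radius `r` about `y` differs from `f y` by at most a multiple of `r^s
a`, where `a^p = g(y) d^(-b)` and `g` is the energy density, and from `c` by at most a multiple of
`r^(-n/q) X`. These are the two inputs of the interpolation inequality, with `R = d/16`. -/
theorem exists_enorm_sub_ballAvg_rpow_le (n : ℕ) {s p q : ℝ} (hs : 0 < s) (hp : 1 ≤ p)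
    (hpq : p ≤ q) (b : ℝ) (hκ : 0 ≤ s * p - n + n * p / q) :
    ∃ C : ℝ, 0 < C ∧ ∀ (Ω : Set (EuclideanSpace ℝ (Fin n))) (f : EuclideanSpace ℝ (Fin n) → ℝ),
      Measurable f → (∃ N, ∀ x, |f x| ≤ N) → ∀ (c X : ℝ), 0 < X →
      ∫⁻ x in Ω, ‖f x - c‖ₑ ^ q ≤ ENNReal.ofReal (X ^ q) → ∀ y ∈ Ω, 0 < bdryDist Ω y →
      ‖f y - ballAvg Ω f y‖ₑ ^ q ≤ ENNReal.ofReal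
        (C * X ^ (q - p) * bdryDist Ω y ^ (s * p - n + n * p / q - b)) *
          energyDensity Ω s p b f y := by
  set v := volume.real (Metric.ball (0 : EuclideanSpace ℝ (Fin n)) 1) with hv
  have hv0 : 0 < v := volume_real_unitBall_pos
  have hp0 : 0 < p := by linarith
  have hq0 : 0 < q := by linarith
  set C₁ := (v⁻¹ * 2 ^ |b|) ^ (1 / p) with hC₁
  set C₂ := (v⁻¹) ^ (1 / q) with hC₂
  have hC₁0 : 0 < C₁ := by positivity
  have hC₂0 : 0 < C₂ := by positivity
  refine ⟨(2 * (C₁ + 2 * C₂)) ^ q, by positivity, fun Ω f hf ⟨N, hN⟩ c X hX hfc y hy hd => ?_⟩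
  set d := bdryDist Ω y with hd'
  obtain he | he := eq_or_ne (energyDensity Ω s p b f y) ⊤
  · rw [he, ENNReal.mul_top]
    · exact le_top
    · rw [ENNReal.ofReal_ne_zero_iff]; positivity
  set A := (energyDensity Ω s p b f y).toReal with hA
  have hA0 : 0 ≤ A := ENNReal.toReal_nonneg
  have hAe : energyDensity Ω s p b f y = ENNReal.ofReal A := (ENNReal.ofReal_toReal he).symm
  set a := (A * d ^ (-b)) ^ (1 / p) with ha
  have ha0 : 0 ≤ a := by positivity
  have hap : a ^ p = A * d ^ (-b) := by
    rw [ha, ← Real.rpow_mul (by positivity), one_div_mul_cancel hp0.ne', Real.rpow_one]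
  have hvol : ∀ r, 0 < r → (volume (Metric.ball y r))⁻¹ = ENNReal.ofReal ((r ^ n * v)⁻¹) := by
    intro r hr
    rw [volume_ball_eq y hr, ENNReal.ofReal_inv_of_pos (by positivity)]
  have hi : ∀ r, 0 < r → r ≤ d / 16 → |(⨍ z in Metric.ball y r, f z) - f y| ≤ C₁ * (r ^ s * a) := by
    intro r hr hrd
    have h1 := enorm_setAverage_sub_rpow_le (μ := volume)
      (Metric.measure_ball_pos volume y hr).ne' measure_ball_lt_top.ne
      (integrableOn_of_abs_le hf hN measure_ball_lt_top.ne) (f y) hp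
    have h2 := setLIntegral_enorm_sub_rpow_le (f := f) (b := b) hs hp0 hr
      (by linarith : r ≤ bdryDist Ω y / 2) (Metric.ball_subset_closedBall (x := y))
    have h3 := h1.trans (mul_le_mul_right h2 _)
    rw [hAe, hvol r hr, ← ENNReal.ofReal_mul (by positivity), ← ENNReal.ofReal_mul (by positivity),
      Real.enorm_eq_ofReal_abs, ENNReal.ofReal_rpow_of_nonneg (abs_nonneg _) hp0.le,
      ENNReal.ofReal_le_ofReal_iff (by positivity)] at h3
    have h4 : (r ^ n * v)⁻¹ * (2 ^ |b| * r ^ ((n : ℝ) + s * p) * d ^ (-b) * A) =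
        (C₁ * (r ^ s * a)) ^ p := by
      rw [Real.mul_rpow hC₁0.le (by positivity), Real.mul_rpow (by positivity) ha0, hap, hC₁,
        ← Real.rpow_mul (by positivity), one_div_mul_cancel hp0.ne', Real.rpow_one,
        ← Real.rpow_mul hr.le, Real.rpow_add hr, Real.rpow_natCast]
      field_simp
    rw [h4] at h3
    exact (Real.rpow_le_rpow_iff (abs_nonneg _) (by positivity) hp0).1 h3
  have hii : ∀ r, 0 < r → r ≤ d / 16 →
      |(⨍ z in Metric.ball y r, f z) - c| ≤ C₂ * (r ^ (-(n : ℝ) / q) * X) := by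
    intro r hr hrd
    have h1 := enorm_setAverage_sub_rpow_le (μ := volume)
      (Metric.measure_ball_pos volume y hr).ne' measure_ball_lt_top.ne
      (integrableOn_of_abs_le hf hN measure_ball_lt_top.ne) c (hp.trans hpq)
    have h2 : ∫⁻ x in Metric.ball y r, ‖f x - c‖ₑ ^ q ≤ ENNReal.ofReal (X ^ q) :=
      (lintegral_mono_set (ball_bdryDist_subset hy (by linarith : r ≤ bdryDist Ω y))).trans hfc
    have h3 := h1.trans (mul_le_mul_right h2 _)
    rw [hvol r hr, ← ENNReal.ofReal_mul (by positivity),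
      Real.enorm_eq_ofReal_abs, ENNReal.ofReal_rpow_of_nonneg (abs_nonneg _) hq0.le,
      ENNReal.ofReal_le_ofReal_iff (by positivity)] at h3
    have h4 : (r ^ n * v)⁻¹ * X ^ q = (C₂ * (r ^ (-(n : ℝ) / q) * X)) ^ q := by
      rw [Real.mul_rpow hC₂0.le (by positivity), Real.mul_rpow (by positivity) hX.le, hC₂,
        ← Real.rpow_mul (by positivity), one_div_mul_cancel hq0.ne', Real.rpow_one,
        ← Real.rpow_mul hr.le, div_mul_cancel₀ _ hq0.ne', Real.rpow_neg hr.le, Real.rpow_natCast]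
      field_simp
    rw [h4] at h3
    exact (Real.rpow_le_rpow_iff (abs_nonneg _) (by positivity) hq0).1 h3
  have hR : 0 < d / 16 := by linarith
  have hfin := rpow_le_of_forall_rpow_add_rpow (w := |f y - ballAvg Ω f y|) (C := C₁ + 2 * C₂)
    (N := n) (s := s) (abs_nonneg _) hX ha0 hR
    (by positivity) (Nat.cast_nonneg n) hs hp0 hpq hκ ?_ ?_
  · rw [hAe, ← ENNReal.ofReal_mul (by positivity), Real.enorm_eq_ofReal_abs,
      ENNReal.ofReal_rpow_of_nonneg (abs_nonneg _) hq0.le]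
    refine ENNReal.ofReal_le_ofReal (hfin.trans ?_)
    rw [hap]
    have h5 : (d / 16) ^ (s * p - n + n * p / q) ≤ d ^ (s * p - n + n * p / q) :=
      Real.rpow_le_rpow hR.le (by linarith) hκ
    calc _ ≤ (2 * (C₁ + 2 * C₂)) ^ q * X ^ (q - p) * (A * d ^ (-b)) *
          d ^ (s * p - n + n * p / q) := by gcongr
      _ = _ := by
        have h6 : d ^ (s * p - n + n * p / q - b) = d ^ (s * p - n + n * p / q) * d ^ (-b) := by
          rw [← Real.rpow_add hd]; congr 1
        rw [h6]
        ring
  · rw [abs_sub_comm]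
    refine (hi (d / 16) hR le_rfl).trans ?_
    gcongr
    linarith
  · intro r hr hrd
    have h1 := hi r hr hrd
    have h2 := hii r hr hrd
    have h3 := hii (d / 16) hR le_rfl
    have h4 : (d / 16) ^ (-(n : ℝ) / q) ≤ r ^ (-(n : ℝ) / q) := by
      refine Real.rpow_le_rpow_of_nonpos hr hrd ?_
      rw [neg_div]
      have : 0 ≤ (n : ℝ) / q := by positivity
      linarith
    have h5 : C₂ * ((d / 16) ^ (-(n : ℝ) / q) * X) ≤ C₂ * (r ^ (-(n : ℝ) / q) * X) := by gcongr
    have h6 : 0 ≤ C₂ * (r ^ s * a) := by positivity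
    have h7 : 0 ≤ C₁ * (r ^ (-(n : ℝ) / q) * X) := by positivity
    -- The path is `f y`, mean over radius `r`, `c`, mean over radius `d/16`; the last two links
    -- share one bound because `r ≤ d/16`, hence `C₁ + 2 * C₂`.
    change |f y - ⨍ z in Metric.ball y (d / 16), f z| ≤ _
    rw [abs_le] at h1 h2 h3 ⊢
    constructor <;> nlinarith [h1.1, h1.2, h2.1, h2.2, h3.1, h3.2]

end Local

/-! ### Reduction to averages of bounded functions. -/

section Reduction

variable {n : ℕ} {Ω : Set (EuclideanSpace ℝ (Fin n))} {s p q b : ℝ}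
  {f : EuclideanSpace ℝ (Fin n) → ℝ} {x : EuclideanSpace ℝ (Fin n)}

theorem lintegral_enorm_sub_rpow_le_add {β : Type*} [MeasurableSpace β] {μ : Measure β}
    {f g h : β → ℝ} (hf : Measurable f) (hg : Measurable g) (hh : Measurable h) (hq : 1 ≤ q) :
    (∫⁻ x, ‖f x - h x‖ₑ ^ q ∂μ) ^ (1 / q) ≤
      (∫⁻ x, ‖f x - g x‖ₑ ^ q ∂μ) ^ (1 / q) + (∫⁻ x, ‖g x - h x‖ₑ ^ q ∂μ) ^ (1 / q) := by
  refine le_trans ?_ (ENNReal.lintegral_Lp_add_le (hf.sub hg).enorm.aemeasurable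
    (hg.sub hh).enorm.aemeasurable hq)
  gcongr with x
  simp only [Pi.add_apply, ← edist_eq_enorm_sub]
  exact edist_triangle _ _ _

theorem lintegral_enorm_rpow_lt_top {S : Set (EuclideanSpace ℝ (Fin n))}
    (hS : volume S ≠ ⊤) {g : EuclideanSpace ℝ (Fin n) → ℝ} {N : ℝ} (hN : ∀ x ∈ S, |g x| ≤ N)
    (hSm : MeasurableSet S) (hq : 0 ≤ q) : ∫⁻ x in S, ‖g x‖ₑ ^ q < ⊤ := by
  calc ∫⁻ x in S, ‖g x‖ₑ ^ q ≤ ∫⁻ x in S, ENNReal.ofReal N ^ q := by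
        refine setLIntegral_mono' hSm fun x hx => ?_
        rw [Real.enorm_eq_ofReal_abs]
        exact ENNReal.rpow_le_rpow (ENNReal.ofReal_le_ofReal (hN x hx)) hq
    _ = ENNReal.ofReal N ^ q * volume S := setLIntegral_const _ _
    _ < ⊤ := ENNReal.mul_lt_top (ENNReal.rpow_lt_top_of_nonneg hq ENNReal.ofReal_ne_top) hS.lt_top

/-- With `X = ‖f - c‖_q` and `Y = ‖f - u‖_q`, the triangle inequality and the integrated local bound
are the hypotheses of the absorption inequality. Boundedness of `f` and finite volume make `X`
finite; `hσ` allows `d^σ ≤ M^σ`. -/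
theorem exists_lintegral_sub_ballAvg_le (hs : 0 < s) (hp : 1 ≤ p) (hpq : p ≤ q)
    (hκ : 0 ≤ s * p - n + n * p / q) (hσ : b ≤ s * p - n + n * p / q)
    (hΩ : IsOpen Ω) (hfr : (frontier Ω).Nonempty) (hvol : volume Ω ≠ ⊤) {M : ℝ}
    (hM : ∀ x ∈ Ω, bdryDist Ω x ≤ M) {x₀ : EuclideanSpace ℝ (Fin n)} (hx₀ : x₀ ∈ Ω)
    (H : ∃ K : ℝ≥0, ∀ f : EuclideanSpace ℝ (Fin n) → ℝ, Measurable f → (∃ N, ∀ x, |f x| ≤ N) →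
      ∫⁻ x in Ω, ‖ballAvg Ω f x - ballAvg Ω f x₀‖ₑ ^ q ≤ K * fracEnergy Ω s p b f ^ (q / p)) :
    ∃ C : ℝ, 0 < C ∧ ∀ f : EuclideanSpace ℝ (Fin n) → ℝ, Measurable f → (∃ N, ∀ x, |f x| ≤ N) →
      (∫⁻ x in Ω, ‖f x - ballAvg Ω f x₀‖ₑ ^ q) ^ (1 / q) ≤
        ENNReal.ofReal C * fracEnergy Ω s p b f ^ (1 / p) := by
  obtain ⟨K, hK⟩ := H
  obtain ⟨C₂, hC₂, hloc⟩ := exists_enorm_sub_ballAvg_rpow_le n hs hp hpq b hκ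
  have hp0 : 0 < p := by linarith
  have hq0 : 0 < q := by linarith
  have hM0 : 0 < M := (bdryDist_pos hΩ hfr hx₀).trans_le (hM _ hx₀)
  set σ := s * p - n + n * p / q - b with hσ'
  set K' : ℝ := (K : ℝ) ^ (1 / q) with hK'
  have hK'0 : 0 ≤ K' := by positivity
  refine ⟨2 * K' + (2 ^ q * (C₂ * M ^ σ)) ^ (1 / p), by positivity, fun f hf hN => ?_⟩
  set c := ballAvg Ω f x₀ with hc
  set Xe := (∫⁻ x in Ω, ‖f x - c‖ₑ ^ q) ^ (1 / q) with hXe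
  set Ye := (∫⁻ x in Ω, ‖f x - ballAvg Ω f x‖ₑ ^ q) ^ (1 / q) with hYe
  obtain hE | hE := eq_or_ne (fracEnergy Ω s p b f) ⊤
  · rw [hE, ENNReal.top_rpow_of_pos (by positivity), ENNReal.mul_top]
    · exact le_top
    · rw [ENNReal.ofReal_ne_zero_iff]; positivity
  obtain hX0 | hX0 := eq_or_ne Xe 0
  · rw [hX0]; exact zero_le
  have hXtop : Xe ≠ ⊤ := by
    obtain ⟨N, hN⟩ := hN
    refine (ENNReal.rpow_lt_top_of_nonneg (by positivity) (lintegral_enorm_rpow_lt_top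
      (N := N + |c|) hvol (fun x _ => ?_) hΩ.measurableSet hq0.le).ne).ne
    exact (abs_sub _ _).trans (by linarith [hN x])
  set X := Xe.toReal with hX
  have hXpos : 0 < X := ENNReal.toReal_pos hX0 hXtop
  have hXXe : Xe = ENNReal.ofReal X := (ENNReal.ofReal_toReal hXtop).symm
  have hEp : fracEnergy Ω s p b f ^ (1 / p) ≠ ⊤ :=
    (ENNReal.rpow_lt_top_of_nonneg (by positivity) hE).ne
  set N := (fracEnergy Ω s p b f ^ (1 / p)).toReal with hN'
  have hN0 : 0 ≤ N := ENNReal.toReal_nonneg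
  have hNE : fracEnergy Ω s p b f ^ (1 / p) = ENNReal.ofReal N :=
    (ENNReal.ofReal_toReal hEp).symm
  have hNE' : fracEnergy Ω s p b f = ENNReal.ofReal (N ^ p) := by
    rw [← ENNReal.ofReal_rpow_of_nonneg hN0 hp0.le, ← hNE, ← ENNReal.rpow_mul,
      one_div_mul_cancel hp0.ne', ENNReal.rpow_one]
  have hXq : ∫⁻ x in Ω, ‖f x - c‖ₑ ^ q ≤ ENNReal.ofReal (X ^ q) := by
    rw [← ENNReal.ofReal_rpow_of_nonneg hXpos.le hq0.le, ← hXXe, hXe, ← ENNReal.rpow_mul,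
      one_div_mul_cancel hq0.ne', ENNReal.rpow_one]
  have hYq : ∫⁻ x in Ω, ‖f x - ballAvg Ω f x‖ₑ ^ q ≤
      ENNReal.ofReal (C₂ * M ^ σ * X ^ (q - p) * N ^ p) := by
    calc ∫⁻ x in Ω, ‖f x - ballAvg Ω f x‖ₑ ^ q
        ≤ ∫⁻ x in Ω, ENNReal.ofReal (C₂ * M ^ σ * X ^ (q - p)) * energyDensity Ω s p b f x := by
          refine setLIntegral_mono' hΩ.measurableSet fun y hy => ?_
          have hd := bdryDist_pos hΩ hfr hy
          refine (hloc Ω f hf hN c X hXpos hXq y hy hd).trans ?_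
          gcongr ENNReal.ofReal ?_ * _
          have : bdryDist Ω y ^ σ ≤ M ^ σ := Real.rpow_le_rpow hd.le (hM y hy) (by linarith)
          calc C₂ * X ^ (q - p) * bdryDist Ω y ^ σ ≤ C₂ * X ^ (q - p) * M ^ σ := by gcongr
            _ = _ := by ring
      _ = ENNReal.ofReal (C₂ * M ^ σ * X ^ (q - p)) * fracEnergy Ω s p b f :=
          lintegral_const_mul' _ _ ENNReal.ofReal_ne_top
      _ = _ := by rw [hNE', ← ENNReal.ofReal_mul (by positivity)]
  have hYtop : Ye ≠ ⊤ := (ENNReal.rpow_lt_top_of_nonneg (by positivity)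
    (hYq.trans_lt ENNReal.ofReal_lt_top).ne).ne
  set Y := Ye.toReal with hY
  have hY0 : 0 ≤ Y := ENNReal.toReal_nonneg
  have hYYe : Ye = ENNReal.ofReal Y := (ENNReal.ofReal_toReal hYtop).symm
  have h2 : Y ^ q ≤ C₂ * M ^ σ * X ^ (q - p) * N ^ p := by
    rw [← ENNReal.ofReal_le_ofReal_iff (by positivity)]
    refine le_trans (le_of_eq ?_) hYq
    rw [← ENNReal.ofReal_rpow_of_nonneg hY0 hq0.le, ← hYYe, hYe, ← ENNReal.rpow_mul,
      one_div_mul_cancel hq0.ne', ENNReal.rpow_one]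
  have h1 : X ≤ Y + K' * N := by
    rw [← ENNReal.ofReal_le_ofReal_iff (by positivity), ENNReal.ofReal_add hY0 (by positivity),
      ENNReal.ofReal_mul hK'0, ← hXXe, ← hYYe, ← hNE]
    refine (lintegral_enorm_sub_rpow_le_add (g := ballAvg Ω f) hf (ballAvg_measurable hf)
      measurable_const (by linarith)).trans (add_le_add le_rfl ?_)
    refine (ENNReal.rpow_le_rpow (hK f hf hN) (by positivity)).trans (le_of_eq ?_)
    rw [ENNReal.mul_rpow_of_nonneg _ _ (by positivity), ← ENNReal.rpow_mul, hK',
      ← ENNReal.ofReal_rpow_of_nonneg (NNReal.coe_nonneg K) (by positivity)]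
    congr 2
    · simp
    · field_simp
  rw [hXXe, hNE, ← ENNReal.ofReal_mul (by positivity)]
  exact ENNReal.ofReal_le_ofReal
    (le_mul_of_le_add_of_rpow_le hXpos hY0 hN0 hK'0 (by positivity) hp0 hpq h1 h2)

theorem abs_max_min_sub_max_min_le (a b N : ℝ) :
    |max (min a N) (-N) - max (min b N) (-N)| ≤ |a - b| :=
  (abs_max_sub_max_le_abs _ _ _).trans (abs_min_sub_min_le_max _ _ _ _ |>.trans (by simp))

theorem fracEnergy_le_of_abs_sub_le (hp : 0 ≤ p) (hΩ : IsOpen Ω) (hfr : (frontier Ω).Nonempty)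
    {g : EuclideanSpace ℝ (Fin n) → ℝ}
    (h : ∀ x ∈ Ω, ∀ z ∈ Ω, |g z - g x| ≤ |f z - f x|) :
    fracEnergy Ω s p b g ≤ fracEnergy Ω s p b f := by
  unfold fracEnergy
  refine setLIntegral_mono' hΩ.measurableSet fun x hx => ?_
  have hm : MeasurableSet {z | dist x z ≤ bdryDist Ω x / 2} :=
    (isClosed_le (by fun_prop) (by fun_prop)).measurableSet
  refine setLIntegral_mono' hm fun z hz => ENNReal.ofReal_le_ofReal ?_
  have hd := bdryDist_pos hΩ hfr hx
  have hzΩ : z ∈ Ω := by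
    refine ball_bdryDist_subset hx le_rfl ?_
    rw [Metric.mem_ball, dist_comm]
    exact hz.trans_lt (by linarith)
  have hδ : 0 ≤ minBdryDist Ω x z := le_min hd.le (Metric.infDist_nonneg)
  gcongr ?_ ^ p / _ * _
  exact h x hx z hzΩ

/-- Truncation does not increase the energy, and Fatou's lemma passes to the limit. The constant is
unaffected: `f` is bounded on the compact ball about `x₀`, so the average there is eventually
unchanged by truncation. -/
theorem exists_iInf_eLpNorm_le (hp : 1 ≤ p) (hq : 0 < q) (hΩ : IsOpen Ω)
    (hfr : (frontier Ω).Nonempty) {x₀ : EuclideanSpace ℝ (Fin n)} (hx₀ : x₀ ∈ Ω)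
    (H : ∃ C : ℝ, 0 < C ∧ ∀ f : EuclideanSpace ℝ (Fin n) → ℝ, Measurable f →
      (∃ N, ∀ x, |f x| ≤ N) →
      (∫⁻ x in Ω, ‖f x - ballAvg Ω f x₀‖ₑ ^ q) ^ (1 / q) ≤
        ENNReal.ofReal C * fracEnergy Ω s p b f ^ (1 / p)) :
    ∃ C : ℝ, 0 < C ∧ ∀ f : EuclideanSpace ℝ (Fin n) → ℝ, ContinuousOn f Ω →
      (⨅ c : ℝ, eLpNorm (fun y => f y - c) (ENNReal.ofReal q) (volume.restrict Ω)) ≤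
        ENNReal.ofReal C * fracEnergy Ω s p b f ^ (1 / p) := by
  obtain ⟨C, hC, H⟩ := H
  refine ⟨C, hC, fun f hf => ?_⟩
  set g := Ω.indicator f with hg
  have hgm : Measurable g := by
    classical
    rw [hg, ← Set.piecewise_eq_indicator]
    exact hf.measurable_piecewise continuousOn_const hΩ.measurableSet
  have hgf : ∀ x ∈ Ω, g x = f x := fun x hx => Set.indicator_of_mem hx f
  have hd := bdryDist_pos hΩ hfr hx₀
  have hBΩ : Metric.closedBall x₀ (bdryDist Ω x₀ / 16) ⊆ Ω :=
    (Metric.closedBall_subset_ball (by linarith)).trans (ball_bdryDist_subset hx₀ le_rfl)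
  obtain ⟨N₀, hN₀⟩ := (isCompact_closedBall x₀ (bdryDist Ω x₀ / 16)).exists_bound_of_continuousOn
    (hf.mono hBΩ)
  set c := ballAvg Ω g x₀ with hc
  let t : ℕ → EuclideanSpace ℝ (Fin n) → ℝ := fun N x => max (min (g x) N) (-N)
  have ht : ∀ x (N : ℕ), |g x| ≤ N → t N x = g x := by
    intro x N h
    rw [abs_le] at h
    simp only [t]
    rw [min_eq_left h.2, max_eq_left h.1]
  have htm : ∀ N, Measurable (t N) := fun N => (hgm.min measurable_const).max measurable_const
  have htb : ∀ N x, |t N x| ≤ N := by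
    intro N x
    have : (0 : ℝ) ≤ N := Nat.cast_nonneg N
    simp only [t]
    rw [abs_le]
    exact ⟨le_max_right _ _, max_le (min_le_right _ _) (by linarith)⟩
  have hE : ∀ N, fracEnergy Ω s p b (t N) ≤ fracEnergy Ω s p b f := by
    intro N
    refine fracEnergy_le_of_abs_sub_le (by linarith) hΩ hfr fun x hx z hz => ?_
    rw [← hgf x hx, ← hgf z hz]
    exact abs_max_min_sub_max_min_le _ _ _
  have hcN : ∀ᶠ N : ℕ in Filter.atTop, ballAvg Ω (t N) x₀ = c := by
    filter_upwards [Filter.eventually_ge_atTop ⌈N₀⌉₊] with N hN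
    refine setAverage_congr_fun Metric.isOpen_ball.measurableSet
      (Filter.Eventually.of_forall fun x hx => ?_)
    have hx' := Metric.ball_subset_closedBall hx
    refine ht x N ?_
    rw [hgf x (hBΩ hx')]
    exact (hN₀ x hx').trans ((Nat.le_ceil _).trans (by exact_mod_cast hN))
  have hlim : ∀ x, Filter.Tendsto (fun N => ‖t N x - ballAvg Ω (t N) x₀‖ₑ ^ q) Filter.atTop
      (nhds (‖g x - c‖ₑ ^ q)) := by
    intro x
    refine tendsto_const_nhds.congr' ?_
    filter_upwards [hcN, Filter.eventually_ge_atTop ⌈|g x|⌉₊] with N hN hN'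
    rw [hN, ht x N ((Nat.le_ceil _).trans (by exact_mod_cast hN'))]
  have hF : ∫⁻ x in Ω, ‖g x - c‖ₑ ^ q ≤
      (ENNReal.ofReal C * fracEnergy Ω s p b f ^ (1 / p)) ^ q := by
    calc ∫⁻ x in Ω, ‖g x - c‖ₑ ^ q
        = ∫⁻ x in Ω, Filter.liminf (fun N => ‖t N x - ballAvg Ω (t N) x₀‖ₑ ^ q) Filter.atTop := by
          refine lintegral_congr fun x => ?_
          exact (hlim x).liminf_eq.symm
      _ ≤ Filter.liminf (fun N => ∫⁻ x in Ω, ‖t N x - ballAvg Ω (t N) x₀‖ₑ ^ q) Filter.atTop :=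
          lintegral_liminf_le fun N => by
            exact (((htm N).sub measurable_const).enorm.pow_const q)
      _ ≤ _ := by
          refine Filter.liminf_le_of_le (by isBoundedDefault) fun a ha => ?_
          obtain ⟨N, hN⟩ := ha.exists
          refine hN.trans ?_
          have h1 := H (t N) (htm N) ⟨N, htb N⟩
          rw [one_div, ENNReal.rpow_inv_le_iff hq] at h1
          refine h1.trans ?_
          gcongr
          exact hE N
  refine (iInf_le _ c).trans ?_
  rw [eLpNorm_eq_lintegral_rpow_enorm_toReal (by simpa using hq) ENNReal.ofReal_ne_top,
    ENNReal.toReal_ofReal hq.le, one_div q, ENNReal.rpow_inv_le_iff hq]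
  refine le_trans (le_of_eq ?_) hF
  refine setLIntegral_congr_fun hΩ.measurableSet fun x hx => ?_
  simp only [hgf x hx]

end Reduction

/-! ### From chains of balls to a line integral. -/

section Chain

variable {U r : ℝ → ℝ} {F : ℝ → ℝ≥0∞} {A B : ℝ}

theorem enorm_sub_le_lintegral_of_le_three_mul {a b : ℝ} (hr : 0 < r a) (hra : r a ≤ b - a)
    (hcomp : ∀ τ ∈ Set.Ioc a b, 0 < r τ ∧ r τ ≤ 2 * r a)
    (hF : ∀ τ ∈ Set.Ioc a b, ‖U a - U b‖ₑ ≤ F τ) :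
    ‖U a - U b‖ₑ ≤ 2 * ∫⁻ t in Set.Ioc a b, ENNReal.ofReal (r t)⁻¹ * F t := by
  calc ‖U a - U b‖ₑ
      ≤ 2 * ((ENNReal.ofReal (2 * r a)⁻¹ * ‖U a - U b‖ₑ) * volume (Set.Ioc a b)) := by
        rw [Real.volume_Ioc]
        have h1 : (1 : ℝ≥0∞) ≤ ENNReal.ofReal (2 * ((2 * r a)⁻¹ * (b - a))) := by
          rw [← ENNReal.ofReal_one]
          refine ENNReal.ofReal_le_ofReal ?_
          rw [mul_inv, ← mul_assoc, ← mul_assoc, mul_inv_cancel₀ (by norm_num), one_mul,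
            inv_mul_eq_div, le_div_iff₀ hr]
          linarith
        calc ‖U a - U b‖ₑ = 1 * ‖U a - U b‖ₑ := (one_mul _).symm
          _ ≤ ENNReal.ofReal (2 * ((2 * r a)⁻¹ * (b - a))) * ‖U a - U b‖ₑ := by gcongr
          _ = _ := by
            rw [ENNReal.ofReal_mul (by norm_num), ENNReal.ofReal_mul (by positivity),
              ENNReal.ofReal_ofNat]
            ring
    _ = 2 * ∫⁻ t in Set.Ioc a b, ENNReal.ofReal (2 * r a)⁻¹ * ‖U a - U b‖ₑ := by
        rw [setLIntegral_const]
    _ ≤ _ := by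
        gcongr 2 * ?_
        refine setLIntegral_mono' measurableSet_Ioc fun t ht => ?_
        obtain ⟨h0, h1⟩ := hcomp t ht
        gcongr
        exact hF t ht

/-- Advance from `a` to `a + r a` while more than `3 * r a` remains, and then jump to `B`. After
each advance at least `2 * r a` is left, which dominates the next step size, so every link has
length between one and three times `r` at its start and is bounded by its own piece of the integral.
-/
theorem enorm_sub_le_lintegral_of_chain {r₀ : ℝ} (hr₀ : 0 < r₀) (hr : ∀ t ∈ Set.Icc A B, r₀ ≤ r t)
    (hcomp : ∀ a ∈ Set.Icc A B, ∀ τ ∈ Set.Icc A B, |τ - a| ≤ 3 * r a → r τ ≤ 2 * r a)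
    (hF : ∀ a ∈ Set.Icc A B, ∀ b ∈ Set.Icc A B, ∀ τ ∈ Set.Icc a b, b - a ≤ 3 * r a →
      ‖U a - U b‖ₑ ≤ F τ) (hle : A ≤ B) (hAB : r A ≤ B - A) :
    ‖U A - U B‖ₑ ≤ 2 * ∫⁻ t in Set.Ioc A B, ENNReal.ofReal (r t)⁻¹ * F t := by
  have short : ∀ a ∈ Set.Icc A B, ∀ b ∈ Set.Icc A B, r a ≤ b - a → b - a ≤ 3 * r a →
      ‖U a - U b‖ₑ ≤ 2 * ∫⁻ t in Set.Ioc a b, ENNReal.ofReal (r t)⁻¹ * F t := by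
    intro a ha b hb h1 h2
    refine enorm_sub_le_lintegral_of_le_three_mul (hr₀.trans_le (hr a ha)) h1 (fun τ hτ => ?_)
      fun τ hτ => hF a ha b hb τ ⟨hτ.1.le, hτ.2⟩ h2
    have hτ' : τ ∈ Set.Icc A B := ⟨ha.1.trans hτ.1.le, hτ.2.trans hb.2⟩
    refine ⟨hr₀.trans_le (hr τ hτ'), hcomp a ha τ hτ' ?_⟩
    rw [abs_of_nonneg (by linarith [hτ.1])]
    linarith [hτ.2]
  -- `N` bounds the number of links, since each has length at least `r₀`.
  have main : ∀ N : ℕ, ∀ a ∈ Set.Icc A B, r a ≤ B - a → B - a ≤ N * r₀ →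
      ‖U a - U B‖ₑ ≤ 2 * ∫⁻ t in Set.Ioc a B, ENNReal.ofReal (r t)⁻¹ * F t := by
    intro N
    induction N with
    | zero =>
      intro a ha h1 h2
      have := hr a ha
      simp at h2
      linarith
    | succ N ih =>
      intro a ha h1 h2
      have hra := hr a ha
      have hB : B ∈ Set.Icc A B := ⟨ha.1.trans ha.2, le_rfl⟩
      obtain h3 | h3 := le_or_gt (B - a) (3 * r a)
      · exact short a ha B hB h1 h3
      · set a' := a + r a with ha'
        have ha'm : a' ∈ Set.Icc A B := ⟨by linarith [ha.1], by linarith⟩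
        have h4 : r a' ≤ 2 * r a := hcomp a ha a' ha'm (by
          rw [ha', add_sub_cancel_left, abs_of_nonneg (by linarith)]; linarith)
        have h5 := short a ha a' ha'm (by simp [ha']) (by simp only [ha']; linarith)
        have h6 := ih a' ha'm (by linarith) (by push_cast at h2; linarith)
        have h7 : Set.Ioc a B = Set.Ioc a a' ∪ Set.Ioc a' B :=
          (Set.Ioc_union_Ioc_eq_Ioc (by linarith) ha'm.2).symm
        rw [h7, lintegral_union measurableSet_Ioc (Set.Ioc_disjoint_Ioc_of_le le_rfl), mul_add]
        refine le_trans ?_ (add_le_add h5 h6)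
        simp only [← edist_eq_enorm_sub]
        exact edist_triangle _ _ _
  obtain ⟨N, hN⟩ := exists_nat_gt ((B - A) / r₀)
  exact main N A ⟨le_rfl, hle⟩ hAB ((div_le_iff₀ hr₀).1 hN.le)

end Chain

/-! ### Oscillation of averages along a vertical segment. -/

section Vertical

variable {n : ℕ} {Ω : Set (EuclideanSpace ℝ (Fin n))} {s p q b : ℝ}

theorem exists_enorm_ballAvg_sub_le_lintegral_segment (hs : 0 < s) (hp : 1 ≤ p) (b : ℝ)
    (Ω : Set (EuclideanSpace ℝ (Fin n))) {e : EuclideanSpace ℝ (Fin n)} (he : ‖e‖ = 1) :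
    ∃ C : ℝ, 0 < C ∧ ∀ f : EuclideanSpace ℝ (Fin n) → ℝ, Measurable f → (∃ N, ∀ x, |f x| ≤ N) →
      ∀ (y : EuclideanSpace ℝ (Fin n)) (h : ℝ), 0 < h → bdryDist Ω y ≤ 64 * h →
      (∀ t ∈ Set.Icc 0 h, 0 < bdryDist Ω (y - t • e)) →
      ‖ballAvg Ω f y - ballAvg Ω f (y - h • e)‖ₑ ≤ ENNReal.ofReal C * ∫⁻ t in Set.Ioc 0 h,
        ENNReal.ofReal (bdryDist Ω (y - t • e))⁻¹ *
          (ENNReal.ofReal (bdryDist Ω (y - t • e) ^ (s * p - n - b)) *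
            ∫⁻ w in Metric.ball (y - t • e) (bdryDist Ω (y - t • e) / 4),
              energyDensity Ω s p b f w) ^ (1 / p) := by
  obtain ⟨C, hC, H⟩ := exists_enorm_ballAvg_sub_ballAvg_le n hs hp b
  have hp0 : 0 < p := by linarith
  refine ⟨2 * (64 * C ^ (1 / p)), by positivity, fun f hf hN y h hh hyh hd => ?_⟩
  set γ : ℝ → EuclideanSpace ℝ (Fin n) := fun t => y - t • e with hγ
  have hdist : ∀ t t', dist (γ t) (γ t') = |t - t'| := by
    intro t t'
    rw [dist_eq_norm, sub_sub_sub_cancel_left, ← sub_smul, norm_smul, he, mul_one,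
      Real.norm_eq_abs, abs_sub_comm]
  have hγc : Continuous γ := by fun_prop
  have hdc : Continuous fun t => bdryDist Ω (γ t) := (continuous_bdryDist Ω).comp hγc
  have hlip : ∀ t t', bdryDist Ω (γ t) ≤ bdryDist Ω (γ t') + |t - t'| := by
    intro t t'
    rw [← hdist]
    exact bdryDist_le_add_dist _ _
  obtain ⟨t₀, ht₀, hmin⟩ := isCompact_Icc.exists_isMinOn (Set.nonempty_Icc.2 hh.le)
    hdc.continuousOn
  -- With step `d/64`, a link of length at most `3d/64` stays within `d(γ τ)/16` of each of its
  -- points `γ τ`, as the comparison of ball averages requires.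
  have hchain := enorm_sub_le_lintegral_of_chain (U := fun t => ballAvg Ω f (γ t))
    (r := fun t => bdryDist Ω (γ t) / 64)
    (F := fun t => (ENNReal.ofReal (C * bdryDist Ω (γ t) ^ (s * p - n - b)) *
            ∫⁻ w in Metric.ball (γ t) (bdryDist Ω (γ t) / 4), energyDensity Ω s p b f w) ^ (1 / p))
    (A := 0) (B := h) (r₀ := bdryDist Ω (γ t₀) / 64) (by linarith [hd t₀ ht₀])
    (fun t ht => by linarith [isMinOn_iff.1 hmin t ht])
    (fun a _ τ _ hτ => by
      have := hlip τ a
      linarith [hd a ‹_›]) ?_ hh.le ?_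
  · simp only [hγ, zero_smul, sub_zero] at hchain
    refine hchain.trans (le_of_eq ?_)
    rw [ENNReal.ofReal_mul (by norm_num), ENNReal.ofReal_ofNat, mul_assoc]
    congr 1
    rw [← lintegral_const_mul' _ _ ENNReal.ofReal_ne_top]
    refine setLIntegral_congr_fun measurableSet_Ioc fun t ht => ?_
    have hdt := hd t ⟨ht.1.le, ht.2⟩
    rw [ENNReal.ofReal_mul hC.le, mul_assoc (ENNReal.ofReal C),
      ENNReal.mul_rpow_of_nonneg (ENNReal.ofReal C) _ (by positivity),
      ENNReal.ofReal_rpow_of_pos hC, inv_div, div_eq_mul_inv, ENNReal.ofReal_mul (by norm_num),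
      ENNReal.ofReal_mul (by norm_num)]
    ring
  · intro a ha b' hb τ hτ hab
    have hτm : τ ∈ Set.Icc 0 h := ⟨ha.1.trans hτ.1, hτ.2.trans hb.2⟩
    rw [one_div, ENNReal.le_rpow_inv_iff hp0]
    have h1 := hlip a τ
    rw [abs_sub_comm, abs_of_nonneg (by linarith [hτ.1])] at h1
    refine H Ω f hf hN (γ τ) (γ a) (γ b') (hd τ hτm) ?_ ?_
    · rw [hdist, abs_sub_comm, abs_of_nonneg (by linarith [hτ.1])]
      linarith [hτ.1, hτ.2]
    · rw [hdist, abs_of_nonneg (by linarith [hτ.2])]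
      linarith [hτ.1, hτ.2]
  · simp only [hγ, zero_smul, sub_zero]
    linarith

/-- Write `d^(-1) = d^(-α) d^(α-1)` and apply Jensen with weight `d^(-α)`. Its mass on the segment
is at most `K`, because `h ≤ K d^α` gives `d^(-α) ≤ K/h` on an interval of length `h`. The surplus
exponent `κ` is nonnegative by `hb`, so `d^κ ≤ M^κ`. -/
theorem exists_enorm_ballAvg_sub_rpow_le_lintegral_segment (hs : 0 < s) (hp : 1 ≤ p)
    (Ω : Set (EuclideanSpace ℝ (Fin n))) {e : EuclideanSpace ℝ (Fin n)} (he : ‖e‖ = 1)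
    {α ν K M : ℝ} (hK : 0 < K) (hM : 0 < M)
    (hb : (p - 1) * (1 - α) - ν ≤ s * p - n - b) :
    ∃ C : ℝ, 0 < C ∧ ∀ f : EuclideanSpace ℝ (Fin n) → ℝ, Measurable f → (∃ N, ∀ x, |f x| ≤ N) →
      ∀ (y : EuclideanSpace ℝ (Fin n)) (h : ℝ), 0 < h → bdryDist Ω y ≤ 64 * h →
      (∀ t ∈ Set.Icc 0 h, 0 < bdryDist Ω (y - t • e) ∧ bdryDist Ω (y - t • e) ≤ M ∧
        h ≤ K * bdryDist Ω (y - t • e) ^ α) →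
      ‖ballAvg Ω f y - ballAvg Ω f (y - h • e)‖ₑ ^ p ≤ ENNReal.ofReal C * ∫⁻ t in Set.Ioc 0 h,
        ENNReal.ofReal (bdryDist Ω (y - t • e) ^ (-1 - ν)) *
            ∫⁻ w in Metric.ball (y - t • e) (bdryDist Ω (y - t • e) / 4),
              energyDensity Ω s p b f w := by
  obtain ⟨C, hC, H⟩ := exists_enorm_ballAvg_sub_le_lintegral_segment hs hp b Ω he
  have hp0 : 0 < p := by linarith
  set κ := s * p - n - b - ((p - 1) * (1 - α) - ν) with hκ
  refine ⟨C ^ p * K ^ (p - 1) * M ^ κ, by positivity, fun f hf hN y h hh hyh hd => ?_⟩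
  set δ : ℝ → ℝ := fun t => bdryDist Ω (y - t • e) with hδ
  set Φ : ℝ → ℝ≥0∞ := fun t => ∫⁻ w in Metric.ball (y - t • e) (bdryDist Ω (y - t • e) / 4),
              energyDensity Ω s p b f w with hΦ
  have hγc : Continuous fun t : ℝ => y - t • e := by fun_prop
  have hδc : Continuous δ := (continuous_bdryDist Ω).comp hγc
  have hδm : Measurable δ := hδc.measurable
  have hΦm : Measurable Φ := by
    have h1 : Φ = fun t => ∫⁻ w, Set.indicator
        {z : ℝ × EuclideanSpace ℝ (Fin n) | dist z.2 (y - z.1 • e) < δ z.1 / 4}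
        (fun z => energyDensity Ω s p b f z.2) (t, w) := by
      funext t
      simp only [hΦ]
      rw [← lintegral_indicator Metric.isOpen_ball.measurableSet]
      rfl
    rw [h1]
    refine Measurable.lintegral_prod_right' (f := Set.indicator _ _) (Measurable.indicator ?_ ?_)
    · exact (energyDensity_measurable hf).comp measurable_snd
    · exact (isOpen_lt (by fun_prop) (by fun_prop)).measurableSet
  have h1 := H f hf hN y h hh hyh fun t ht => (hd t ht).1
  have h2 : ∫⁻ t in Set.Ioc 0 h, ENNReal.ofReal (δ t)⁻¹ *
      (ENNReal.ofReal (δ t ^ (s * p - n - b)) * Φ t) ^ (1 / p) =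
      ∫⁻ t in Set.Ioc 0 h, ENNReal.ofReal (δ t ^ (-α)) * (ENNReal.ofReal (δ t ^ (α - 1)) *
      (ENNReal.ofReal (δ t ^ (s * p - n - b)) * Φ t) ^ (1 / p)) := by
    refine setLIntegral_congr_fun measurableSet_Ioc fun t ht => ?_
    have hdt : 0 < δ t := (hd t ⟨ht.1.le, ht.2⟩).1
    rw [← mul_assoc, ← ENNReal.ofReal_mul (by positivity), ← Real.rpow_add hdt]
    congr 2
    rw [← Real.rpow_neg_one]
    congr 1
    ring
  have h3 := lintegral_mul_rpow_le (μ := volume.restrict (Set.Ioc 0 h))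
    (w := fun t => ENNReal.ofReal (δ t ^ (-α))) (k := fun t => ENNReal.ofReal (δ t ^ (α - 1)) *
      (ENNReal.ofReal (δ t ^ (s * p - n - b)) * Φ t) ^ (1 / p)) (by fun_prop) (by fun_prop) hp
  have h4 : ∫⁻ t in Set.Ioc 0 h, ENNReal.ofReal (δ t ^ (-α)) ≤ ENNReal.ofReal K := by
    calc ∫⁻ t in Set.Ioc 0 h, ENNReal.ofReal (δ t ^ (-α))
        ≤ ∫⁻ t in Set.Ioc 0 h, ENNReal.ofReal (K / h) := by
          refine setLIntegral_mono' measurableSet_Ioc fun t ht => ENNReal.ofReal_le_ofReal ?_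
          obtain ⟨hdt, -, hht⟩ := hd t ⟨ht.1.le, ht.2⟩
          rw [Real.rpow_neg hdt.le, le_div_iff₀ hh, inv_mul_le_iff₀ (by positivity)]
          linarith
      _ = ENNReal.ofReal K := by
          rw [setLIntegral_const, Real.volume_Ioc, ← ENNReal.ofReal_mul (by positivity)]
          congr 1
          field_simp
          ring
  have h5 : ∫⁻ t in Set.Ioc 0 h, ENNReal.ofReal (δ t ^ (-α)) * (ENNReal.ofReal (δ t ^ (α - 1)) *
      (ENNReal.ofReal (δ t ^ (s * p - n - b)) * Φ t) ^ (1 / p)) ^ p ≤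
      ENNReal.ofReal (M ^ κ) * ∫⁻ t in Set.Ioc 0 h, ENNReal.ofReal (δ t ^ (-1 - ν)) * Φ t := by
    rw [← lintegral_const_mul' _ _ ENNReal.ofReal_ne_top]
    refine setLIntegral_mono' measurableSet_Ioc fun t ht => ?_
    obtain ⟨hdt, hdM, -⟩ := hd t ⟨ht.1.le, ht.2⟩
    have hdt : 0 < δ t := hdt
    have hdM : δ t ≤ M := hdM
    rw [ENNReal.mul_rpow_of_nonneg _ _ hp0.le, ← ENNReal.rpow_mul, one_div_mul_cancel hp0.ne',
      ENNReal.rpow_one, ENNReal.ofReal_rpow_of_nonneg (by positivity) hp0.le, ← mul_assoc,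
      ← mul_assoc, ← mul_assoc, ← ENNReal.ofReal_mul (by positivity),
      ← ENNReal.ofReal_mul (by positivity), ← ENNReal.ofReal_mul (by positivity)]
    gcongr ENNReal.ofReal ?_ * _
    calc δ t ^ (-α) * (δ t ^ (α - 1)) ^ p * δ t ^ (s * p - n - b) = δ t ^ κ * δ t ^ (-1 - ν) := by
          rw [← Real.rpow_mul hdt.le, ← Real.rpow_add hdt, ← Real.rpow_add hdt,
            ← Real.rpow_add hdt]
          congr 1
          rw [hκ]
          ring
      _ ≤ _ := by
          gcongr
  calc _ ≤ (ENNReal.ofReal C * ∫⁻ t in Set.Ioc 0 h, ENNReal.ofReal (δ t)⁻¹ *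
        (ENNReal.ofReal (δ t ^ (s * p - n - b)) * Φ t) ^ (1 / p)) ^ p :=
        ENNReal.rpow_le_rpow h1 hp0.le
    _ ≤ ENNReal.ofReal (C ^ p) * (ENNReal.ofReal (K ^ (p - 1)) * (ENNReal.ofReal (M ^ κ) *
        ∫⁻ t in Set.Ioc 0 h, ENNReal.ofReal (δ t ^ (-1 - ν)) * Φ t)) := by
        rw [h2, ENNReal.mul_rpow_of_nonneg _ _ hp0.le, ENNReal.ofReal_rpow_of_pos hC]
        gcongr
        refine h3.trans ?_
        rw [← ENNReal.ofReal_rpow_of_pos hK]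
        gcongr
    _ = _ := by
        rw [← mul_assoc, ← mul_assoc, ← ENNReal.ofReal_mul (by positivity),
          ← ENNReal.ofReal_mul (by positivity)]

end Vertical

/-! ### Graph coordinates, shadows and the shadow operator. -/

section Coordinates

variable {n : ℕ} {Ω : Set (EuclideanSpace ℝ (Fin n))}
  (T : EuclideanSpace ℝ (Fin n) ≃ₗᵢ[ℝ] WithLp 2 (EuclideanSpace ℝ (Fin (n - 1)) × ℝ))

/-- The unit vector of the last coordinate direction of the coordinate system `T`. -/
noncomputable def vertDir : EuclideanSpace ℝ (Fin n) := T.symm (WithLp.toLp 2 (0, 1))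

theorem norm_vertDir : ‖vertDir T‖ = 1 := by
  rw [vertDir, LinearIsometryEquiv.norm_map, WithLp.norm_toLp_snd, norm_one]

theorem fst_sub_smul_vertDir (y : EuclideanSpace ℝ (Fin n)) (t : ℝ) :
    (T (y - t • vertDir T)).fst = (T y).fst := by
  simp [vertDir]

theorem snd_sub_smul_vertDir (y : EuclideanSpace ℝ (Fin n)) (t : ℝ) :
    (T (y - t • vertDir T)).snd = (T y).snd - t := by
  simp [vertDir]

theorem continuous_fst_coord : Continuous fun x => (T x).fst :=
  (WithLp.prod_continuous_ofLp 2 _ _).fst.comp T.continuous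

theorem continuous_snd_coord : Continuous fun x => (T x).snd :=
  (WithLp.prod_continuous_ofLp 2 _ _).snd.comp T.continuous

theorem dist_fst_coord_le (x y : EuclideanSpace ℝ (Fin n)) :
    dist (T x).fst (T y).fst ≤ dist x y := by
  rw [← T.dist_map x y]
  exact WithLp.dist_fst_le _ _

theorem abs_snd_coord_sub_le (x y : EuclideanSpace ℝ (Fin n)) :
    |(T x).snd - (T y).snd| ≤ dist x y := by
  rw [← T.dist_map x y, ← Real.dist_eq]
  exact WithLp.dist_snd_le _ _

/-- Uniqueness of Haar measure up to a factor; the value of the factor is never needed. -/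
theorem exists_lintegral_eq_lintegral_coord :
    ∃ c : ℝ≥0, c ≠ 0 ∧ ∀ g : EuclideanSpace ℝ (Fin n) → ℝ≥0∞, Measurable g →
      ∫⁻ x, g x = c * ∫⁻ x' : EuclideanSpace ℝ (Fin (n - 1)), ∫⁻ t : ℝ,
        g (T.symm (WithLp.toLp 2 (x', t))) := by
  let L : (EuclideanSpace ℝ (Fin (n - 1)) × ℝ) ≃L[ℝ] EuclideanSpace ℝ (Fin n) :=
    (WithLp.prodContinuousLinearEquiv 2 ℝ (EuclideanSpace ℝ (Fin (n - 1))) ℝ).symm.trans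
      T.symm.toContinuousLinearEquiv
  have hμ := L.isAddHaarMeasure_map ((volume : Measure (EuclideanSpace ℝ (Fin (n - 1)))).prod
    (volume : Measure ℝ))
  set μ := Measure.map L ((volume : Measure (EuclideanSpace ℝ (Fin (n - 1)))).prod
    (volume : Measure ℝ)) with hμdef
  refine ⟨(volume : Measure (EuclideanSpace ℝ (Fin n))).addHaarScalarFactor μ,
    (Measure.addHaarScalarFactor_pos_of_isAddHaarMeasure _ _).ne', fun g hg => ?_⟩
  have h := Measure.isAddLeftInvariant_eq_smul (volume : Measure (EuclideanSpace ℝ (Fin n))) μ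
  have hLm : Measurable L := L.continuous.measurable
  calc ∫⁻ x, g x = ∫⁻ x, g x ∂((volume : Measure (EuclideanSpace ℝ (Fin n))).addHaarScalarFactor μ • μ) := by
        rw [← h]
    _ = (volume : Measure (EuclideanSpace ℝ (Fin n))).addHaarScalarFactor μ * ∫⁻ x, g x ∂μ := by
        rw [lintegral_smul_measure]; rfl
    _ = _ := by
        congr 1
        have hgL : Measurable fun z => g (L z) := hg.comp hLm
        rw [hμdef, lintegral_map hg hLm, lintegral_prod _ hgL.aemeasurable]
        rfl

theorem exists_volume_cylinder_le (hn : 1 ≤ n) :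
    ∃ C : ℝ, 0 < C ∧ ∀ (x' : EuclideanSpace ℝ (Fin (n - 1))) (t ρ ρ' : ℝ), 0 < ρ → 0 ≤ ρ' →
      volume {y | dist (T y).fst x' ≤ ρ ∧ |(T y).snd - t| ≤ ρ'} ≤
        ENNReal.ofReal (C * (ρ ^ ((n : ℝ) - 1) * ρ')) := by
  obtain ⟨c, hc, H⟩ := exists_lintegral_eq_lintegral_coord T
  set v := volume.real (Metric.ball (0 : EuclideanSpace ℝ (Fin (n - 1))) 1) with hv
  have hv0 : 0 < v := volume_real_unitBall_pos
  have hc0 : 0 < (c : ℝ) := by positivity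
  refine ⟨c * v * 2, by positivity, fun x' t ρ ρ' hρ hρ' => ?_⟩
  have h1 := continuous_fst_coord T
  have h2 := continuous_snd_coord T
  have hm : MeasurableSet {y | dist (T y).fst x' ≤ ρ ∧ |(T y).snd - t| ≤ ρ'} := by
    have h3 : IsClosed {y | dist (T y).fst x' ≤ ρ} := isClosed_le (by fun_prop) (by fun_prop)
    have h4 : IsClosed {y | |(T y).snd - t| ≤ ρ'} := isClosed_le (by fun_prop) (by fun_prop)
    exact (h3.inter h4).measurableSet
  rw [← lintegral_indicator_one hm, H _ (measurable_one.indicator hm)]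
  have h3 : ∀ (z : EuclideanSpace ℝ (Fin (n - 1))) (r : ℝ),
      Set.indicator {y | dist (T y).fst x' ≤ ρ ∧ |(T y).snd - t| ≤ ρ'} 
        (1 : EuclideanSpace ℝ (Fin n) → ℝ≥0∞)
        (T.symm (WithLp.toLp 2 (z, r))) =
      (Metric.closedBall x' ρ).indicator 1 z * (Metric.closedBall t ρ').indicator 1 r := by
    intro z r
    classical
    simp only [Set.indicator_apply, Set.mem_ofPred_eq, LinearIsometryEquiv.apply_symm_apply,
      WithLp.toLp_fst, WithLp.toLp_snd, Metric.mem_closedBall, Real.dist_eq, Pi.one_apply]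
    by_cases ha : dist z x' ≤ ρ <;> by_cases hb : |r - t| ≤ ρ' <;> simp [ha, hb]
  simp only [h3]
  have h4 : ∀ z : EuclideanSpace ℝ (Fin (n - 1)), ∫⁻ r : ℝ,
      (Metric.closedBall x' ρ).indicator 1 z * (Metric.closedBall t ρ').indicator 1 r =
      (Metric.closedBall x' ρ).indicator 1 z * ENNReal.ofReal (2 * ρ') := by
    intro z
    rw [lintegral_const_mul _ (measurable_one.indicator Metric.isClosed_closedBall.measurableSet),
      lintegral_indicator_one Metric.isClosed_closedBall.measurableSet, Real.volume_closedBall]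
  simp only [h4]
  rw [lintegral_mul_const _ (measurable_one.indicator Metric.isClosed_closedBall.measurableSet),
    lintegral_indicator_one Metric.isClosed_closedBall.measurableSet,
    Measure.addHaar_closedBall _ _ hρ.le, finrank_euclideanSpace, Fintype.card_fin,
    ← ofReal_measureReal measure_ball_lt_top.ne, ← hv, ← ENNReal.ofReal_mul (by positivity),
    ← ENNReal.ofReal_mul (by positivity), ← ENNReal.ofReal_coe_nnreal,
    ← ENNReal.ofReal_mul (by positivity)]
  refine ENNReal.ofReal_le_ofReal (le_of_eq ?_)
  have h5 : ρ ^ ((n : ℝ) - 1) = ρ ^ (n - 1) := by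
    rw [← Real.rpow_natCast, Nat.cast_sub hn, Nat.cast_one]
  rw [h5]
  ring

/-- The pairs `(x, y)` such that `y` lies in the shadow of `x`. -/
def shadow (Ω : Set (EuclideanSpace ℝ (Fin n))) (α K : ℝ) :
    Set (EuclideanSpace ℝ (Fin n) × EuclideanSpace ℝ (Fin n)) :=
  {z | dist (T z.2).fst (T z.1).fst ≤ bdryDist Ω z.1 ∧
    |(T z.2).snd - (T z.1).snd| ≤ K * bdryDist Ω z.1 ^ α}

theorem measurableSet_shadow (α K : ℝ) : MeasurableSet (shadow T Ω α K) := by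
  have h2 := (continuous_snd_coord T).measurable
  have h3 := (continuous_bdryDist Ω).measurable
  have h4 := continuous_fst_coord T
  exact (measurableSet_le
    (Continuous.dist (h4.comp continuous_snd) (h4.comp continuous_fst)).measurable
    (h3.comp measurable_fst)).inter (measurableSet_le
    ((h2.comp measurable_snd).sub (h2.comp measurable_fst)).norm
    (((h3.comp measurable_fst).pow_const α).const_mul K))

/-- By Fubini, fix `w`: the times `t` whose ball contains `w` lie in an interval of length `2 d(w)`,
which raises the exponent `-1 - ν` to `-ν`, and such times exist only if `y` is in the shadow of
`w`. -/
theorem exists_lintegral_segment_le_lintegral_shadow (hΩ : IsOpen Ω)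
    {α ν K M : ℝ} (hα : α ≤ 1) (hα0 : 0 ≤ α) (hK : 0 < K) (hM : 0 < M)
    (hΩM : ∀ x ∈ Ω, 0 < bdryDist Ω x ∧ bdryDist Ω x ≤ M) :
    ∃ C : ℝ, 0 < C ∧ ∃ K' : ℝ, 0 < K' ∧
    ∀ g : EuclideanSpace ℝ (Fin n) → ℝ≥0∞, Measurable g →
      ∀ (y : EuclideanSpace ℝ (Fin n)) (h : ℝ), 0 < h →
      (∀ t ∈ Set.Icc 0 h, y - t • vertDir T ∈ Ω ∧
        h ≤ K * bdryDist Ω (y - t • vertDir T) ^ α) →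
      ∫⁻ t in Set.Ioc 0 h, ENNReal.ofReal (bdryDist Ω (y - t • vertDir T) ^ (-1 - ν)) *
            ∫⁻ w in Metric.ball (y - t • vertDir T) (bdryDist Ω (y - t • vertDir T) / 4), g w ≤
      ENNReal.ofReal C * ∫⁻ x in Ω, g x * (shadow T Ω α K').indicator
        (fun z => ENNReal.ofReal (bdryDist Ω z.1 ^ (-ν))) (x, y) := by
  -- In the shadow constant, `K * 2 ^ α` bounds the height travelled from `y`, and `M ^ (1 - α)`
  -- comes from `d ≤ M^(1-α) d^α`, covering the offset of `w` from the segment.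
  refine ⟨2 ^ |-1 - ν| * 2, by positivity, K * 2 ^ α + M ^ (1 - α), by positivity,
    fun g hg y h hh hd => ?_⟩
  set K' := K * 2 ^ α + M ^ (1 - α) with hK'
  set e := vertDir T with he
  set γ : ℝ → EuclideanSpace ℝ (Fin n) := fun t => y - t • e with hγ
  set δ : ℝ → ℝ := fun t => bdryDist Ω (γ t) with hδ
  have hγc : Continuous γ := by fun_prop
  have hδc : Continuous δ := (continuous_bdryDist Ω).comp hγc
  have hdist : ∀ t t', dist (γ t) (γ t') = |t - t'| := by
    intro t t'
    rw [dist_eq_norm, sub_sub_sub_cancel_left, ← sub_smul, norm_smul, norm_vertDir, mul_one,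
      Real.norm_eq_abs, abs_sub_comm]
  set S : Set (ℝ × EuclideanSpace ℝ (Fin n)) := {z | dist z.2 (γ z.1) < δ z.1 / 4} with hS
  have hSm : MeasurableSet S := (isOpen_lt (by fun_prop) (by fun_prop)).measurableSet
  have hcompare : ∀ t ∈ Set.Ioc 0 h, ∀ w, (t, w) ∈ S →
      bdryDist Ω w ≤ 2 * δ t ∧ 3 * δ t ≤ 4 * bdryDist Ω w := by
    intro t ht w hw
    have hw : dist w (γ t) < δ t / 4 := hw
    have h1 : δ t ≤ bdryDist Ω w + dist (γ t) w := bdryDist_le_add_dist _ _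
    have h2 : bdryDist Ω w ≤ δ t + dist w (γ t) := bdryDist_le_add_dist _ _
    have h3 := (hΩM _ (hd t ⟨ht.1.le, ht.2⟩).1).1
    have h3 : 0 < δ t := h3
    rw [dist_comm] at h1
    constructor <;> linarith
  calc ∫⁻ t in Set.Ioc 0 h, ENNReal.ofReal (δ t ^ (-1 - ν)) * ∫⁻ w in Metric.ball (γ t) (δ t / 4), g w
      = ∫⁻ t in Set.Ioc 0 h, ∫⁻ w in Ω, g w *
          S.indicator (fun z => ENNReal.ofReal (δ z.1 ^ (-1 - ν))) (t, w) := by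
        refine setLIntegral_congr_fun measurableSet_Ioc fun t ht => ?_
        have hsub : Metric.ball (γ t) (δ t / 4) ⊆ Ω := by
          have h3 := (hΩM _ (hd t ⟨ht.1.le, ht.2⟩).1).1
          have h3 : 0 < δ t := h3
          exact ball_bdryDist_subset (hd t ⟨ht.1.le, ht.2⟩).1 (by change δ t / 4 ≤ δ t; linarith)
        classical
        rw [← lintegral_const_mul' _ _ ENNReal.ofReal_ne_top,
          ← lintegral_indicator Metric.isOpen_ball.measurableSet, ← lintegral_indicator
          hΩ.measurableSet]
        refine lintegral_congr fun w => ?_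
        by_cases hw : w ∈ Metric.ball (γ t) (δ t / 4)
        · have hw' : (t, w) ∈ S := hw
          rw [Set.indicator_of_mem hw, Set.indicator_of_mem (hsub hw), Set.indicator_of_mem hw',
            mul_comm]
        · have hw' : (t, w) ∉ S := hw
          rw [Set.indicator_of_notMem hw, Set.indicator_apply, Set.indicator_of_notMem hw',
            mul_zero, ite_self]
    _ = ∫⁻ w in Ω, ∫⁻ t in Set.Ioc 0 h, g w *
          S.indicator (fun z => ENNReal.ofReal (δ z.1 ^ (-1 - ν))) (t, w) := by
        refine lintegral_lintegral_swap (Measurable.aemeasurable ?_)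
        refine (hg.comp measurable_snd).mul (Measurable.indicator ?_ hSm)
        have := hδc.measurable
        fun_prop
    _ ≤ ∫⁻ w in Ω, ENNReal.ofReal (2 ^ |-1 - ν| * 2) * (g w * (shadow T Ω α K').indicator
        (fun z => ENNReal.ofReal (bdryDist Ω z.1 ^ (-ν))) (w, y)) := by
        refine setLIntegral_mono' hΩ.measurableSet fun w hw => ?_
        obtain ⟨hdw, hdwM⟩ := hΩM w hw
        rw [lintegral_const_mul]
        swap
        · refine Measurable.indicator ?_ hSm |>.comp measurable_prodMk_right
          have := hδc.measurable
          fun_prop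
        rw [mul_left_comm]
        gcongr g w * ?_
        by_cases hex : ∃ t₀ ∈ Set.Ioc 0 h, (t₀, w) ∈ S
        · obtain ⟨t₀, ht₀, ht₀S⟩ := hex
          obtain ⟨hc1, hc2⟩ := hcompare t₀ ht₀ w ht₀S
          have hδ₀ : 0 < δ t₀ := by linarith
          have hwS : dist w (γ t₀) < δ t₀ / 4 := ht₀S
          have hsh : (w, y) ∈ shadow T Ω α K' := by
            constructor
            · change dist (T y).fst (T w).fst ≤ bdryDist Ω w
              rw [← fst_sub_smul_vertDir T y t₀]
              refine (dist_fst_coord_le T _ _).trans ?_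
              rw [dist_comm]
              exact hwS.le.trans (by linarith)
            · change |(T y).snd - (T w).snd| ≤ K' * bdryDist Ω w ^ α
              have h1 := abs_snd_coord_sub_le T (γ t₀) w
              have h2 : (T (γ t₀)).snd = (T y).snd - t₀ := snd_sub_smul_vertDir T y t₀
              rw [h2, dist_comm] at h1
              have h3 : t₀ ≤ K * 2 ^ α * bdryDist Ω w ^ α := by
                calc t₀ ≤ h := ht₀.2
                  _ ≤ K * δ t₀ ^ α := (hd t₀ ⟨ht₀.1.le, ht₀.2⟩).2
                  _ ≤ K * (2 * bdryDist Ω w) ^ α := by gcongr; linarith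
                  _ = _ := by rw [Real.mul_rpow (by norm_num) hdw.le]; ring
              have h4 : bdryDist Ω w ≤ M ^ (1 - α) * bdryDist Ω w ^ α := by
                calc bdryDist Ω w = bdryDist Ω w ^ (1 - α) * bdryDist Ω w ^ α := by
                      rw [← Real.rpow_add hdw]; simp
                  _ ≤ _ := by
                      gcongr
              have h5 : K' * bdryDist Ω w ^ α = K * 2 ^ α * bdryDist Ω w ^ α +
                M ^ (1 - α) * bdryDist Ω w ^ α := by rw [hK']; ring
              rw [h5]
              rw [abs_le] at h1 ⊢
              constructor <;> linarith [h1.1, h1.2, ht₀.1]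
          rw [Set.indicator_of_mem hsh]
          calc ∫⁻ t in Set.Ioc 0 h, S.indicator (fun z => ENNReal.ofReal (δ z.1 ^ (-1 - ν))) (t, w)
              ≤ ∫⁻ t in Set.Ioc 0 h, (Metric.closedBall t₀ (bdryDist Ω w)).indicator
                (fun _ => ENNReal.ofReal (2 ^ |-1 - ν| * bdryDist Ω w ^ (-1 - ν))) t := by
                refine setLIntegral_mono' measurableSet_Ioc fun t ht => ?_
                by_cases htS : (t, w) ∈ S
                · obtain ⟨hc3, hc4⟩ := hcompare t ht w htS
                  have htS' : dist w (γ t) < δ t / 4 := htS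
                  have htm : t ∈ Metric.closedBall t₀ (bdryDist Ω w) := by
                    rw [Metric.mem_closedBall, Real.dist_eq, ← hdist]
                    have := dist_triangle_left (γ t) (γ t₀) w
                    linarith
                  rw [Set.indicator_of_mem htS, Set.indicator_of_mem htm]
                  refine ENNReal.ofReal_le_ofReal ?_
                  exact Real.rpow_le_two_rpow_abs_mul (by linarith) hdw (by linarith) hc3 _
                · rw [Set.indicator_of_notMem htS]
                  exact zero_le
            _ ≤ ∫⁻ t, (Metric.closedBall t₀ (bdryDist Ω w)).indicator
                (fun _ => ENNReal.ofReal (2 ^ |-1 - ν| * bdryDist Ω w ^ (-1 - ν))) t :=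
                setLIntegral_le_lintegral _ _
            _ = ENNReal.ofReal (2 ^ |-1 - ν| * bdryDist Ω w ^ (-1 - ν)) *
                  ENNReal.ofReal (2 * bdryDist Ω w) := by
                rw [lintegral_indicator_const Metric.isClosed_closedBall.measurableSet,
                  Real.volume_closedBall]
            _ = _ := by
                rw [← ENNReal.ofReal_mul (by positivity), ← ENNReal.ofReal_mul (by positivity)]
                congr 1
                have : bdryDist Ω w ^ (-ν) = bdryDist Ω w ^ (-1 - ν) * bdryDist Ω w := by
                  nth_rw 3 [← Real.rpow_one (bdryDist Ω w)]
                  rw [← Real.rpow_add hdw]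
                  congr 1
                  ring
                rw [this]
                ring
        · push Not at hex
          have : ∫⁻ t in Set.Ioc 0 h, S.indicator (fun z => ENNReal.ofReal (δ z.1 ^ (-1 - ν)))
              (t, w) = 0 := by
            rw [setLIntegral_congr_fun measurableSet_Ioc (g := fun _ => 0)
              (fun t ht => Set.indicator_of_notMem (hex t ht) _)]
            simp
          rw [this]
          exact zero_le
    _ = _ := lintegral_const_mul' _ _ ENNReal.ofReal_ne_top

/-- Jensen for the measure `g dx` and Fubini reduce this to the integral in `y` of the kernel to the
power `r`. That is `d^(-νr)` times the volume of a shadow, of order `d^(n-1+α)`, and `hν` makes the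
powers cancel. -/
theorem exists_lintegral_shadow_rpow_le (hn : 1 ≤ n) (hΩ : IsOpen Ω) {α ν K r : ℝ}
    (hK : 0 < K) (hr : 1 ≤ r) (hν : ν * r = n - 1 + α) (hΩd : ∀ x ∈ Ω, 0 < bdryDist Ω x) :
    ∃ C : ℝ, 0 < C ∧ ∀ g : EuclideanSpace ℝ (Fin n) → ℝ≥0∞, Measurable g →
      ∫⁻ y, (∫⁻ x in Ω, g x * (shadow T Ω α K).indicator
        (fun z => ENNReal.ofReal (bdryDist Ω z.1 ^ (-ν))) (x, y)) ^ r ≤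
      ENNReal.ofReal C * (∫⁻ x in Ω, g x) ^ r := by
  obtain ⟨C, hC, H⟩ := exists_volume_cylinder_le T hn
  refine ⟨C * K, by positivity, fun g hg => ?_⟩
  have hr0 : 0 < r := by linarith
  have hdm := (continuous_bdryDist Ω).measurable
  have hsm := measurableSet_shadow T (Ω := Ω) α K
  have hkm : Measurable ((shadow T Ω α K).indicator
        (fun z => ENNReal.ofReal (bdryDist Ω z.1 ^ (-ν)))) :=
    Measurable.indicator (by fun_prop) hsm
  calc ∫⁻ y, (∫⁻ x in Ω, g x * (shadow T Ω α K).indicator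
        (fun z => ENNReal.ofReal (bdryDist Ω z.1 ^ (-ν))) (x, y)) ^ r
      ≤ ∫⁻ y, (∫⁻ x in Ω, g x) ^ (r - 1) * ∫⁻ x in Ω, g x * (shadow T Ω α K).indicator
        (fun z => ENNReal.ofReal (bdryDist Ω z.1 ^ (-ν))) (x, y) ^ r :=
        lintegral_mono fun y => lintegral_mul_rpow_le hg (hkm.comp measurable_prodMk_right) hr
    _ = (∫⁻ x in Ω, g x) ^ (r - 1) * ∫⁻ x in Ω, ∫⁻ y, g x * (shadow T Ω α K).indicator
        (fun z => ENNReal.ofReal (bdryDist Ω z.1 ^ (-ν))) (x, y) ^ r := by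
        have hm : Measurable fun z : EuclideanSpace ℝ (Fin n) × EuclideanSpace ℝ (Fin n) =>
            g z.2 * (shadow T Ω α K).indicator
              (fun z => ENNReal.ofReal (bdryDist Ω z.1 ^ (-ν))) (z.2, z.1) ^ r :=
          (hg.comp measurable_snd).mul ((hkm.comp measurable_swap).pow_const r)
        rw [lintegral_const_mul _ (Measurable.lintegral_prod_right' hm),
          lintegral_lintegral_swap hm.aemeasurable]
    _ ≤ (∫⁻ x in Ω, g x) ^ (r - 1) * ∫⁻ x in Ω, g x * ENNReal.ofReal (C * K) := by
        gcongr _ * ?_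
        refine setLIntegral_mono' hΩ.measurableSet fun x hx => ?_
        have hd := hΩd x hx
        have hkx : Measurable fun y => (shadow T Ω α K).indicator
            (fun z => ENNReal.ofReal (bdryDist Ω z.1 ^ (-ν))) (x, y) ^ r :=
          (hkm.comp measurable_prodMk_left).pow_const r
        rw [lintegral_const_mul _ hkx]
        gcongr g x * ?_
        set A := {y | dist (T y).fst (T x).fst ≤ bdryDist Ω x ∧
          |(T y).snd - (T x).snd| ≤ K * bdryDist Ω x ^ α} with hA
        have hAm : MeasurableSet A := measurable_prodMk_left hsm
        have h1 : ∀ y, (shadow T Ω α K).indicator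
            (fun z => ENNReal.ofReal (bdryDist Ω z.1 ^ (-ν))) (x, y) ^ r =
            A.indicator (fun _ => ENNReal.ofReal (bdryDist Ω x ^ (-ν * r))) y := by
          intro y
          by_cases hy : y ∈ A
          · have hy' : (x, y) ∈ shadow T Ω α K := hy
            rw [Set.indicator_of_mem hy, Set.indicator_of_mem hy',
              ENNReal.ofReal_rpow_of_pos (by positivity), ← Real.rpow_mul hd.le]
          · have hy' : (x, y) ∉ shadow T Ω α K := hy
            rw [Set.indicator_of_notMem hy, Set.indicator_of_notMem hy',
              ENNReal.zero_rpow_of_pos hr0]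
        simp only [h1]
        rw [lintegral_indicator_const hAm]
        refine (mul_le_mul_right (H (T x).fst (T x).snd _ _ hd (by positivity)) _).trans ?_
        rw [← ENNReal.ofReal_mul (by positivity)]
        refine ENNReal.ofReal_le_ofReal (le_of_eq ?_)
        have h2 : bdryDist Ω x ^ (-ν * r) * (bdryDist Ω x ^ ((n : ℝ) - 1) * bdryDist Ω x ^ α) = 1 := by
          rw [← Real.rpow_add hd, ← Real.rpow_add hd, neg_mul, hν, neg_add_cancel, Real.rpow_zero]
        linear_combination (C * K) * h2
    _ = _ := by
        rw [lintegral_mul_const _ hg, ← mul_assoc, mul_comm]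
        congr 1
        nth_rw 2 [← ENNReal.rpow_one (∫⁻ x in Ω, g x)]
        rw [← ENNReal.rpow_add_of_nonneg _ _ (by linarith) zero_le_one, sub_add_cancel]

end Coordinates

theorem lintegral_comp_two_mul_sub (G : ℝ → ℝ≥0∞) (hG : Measurable G) (a : ℝ) :
    ∫⁻ t, G (2 * t - a) = 2⁻¹ * ∫⁻ t, G t := by
  have h1 : ∫⁻ t, G t = ENNReal.ofReal |2| * ∫⁻ t, G (2 * t - a) := by
    have h2 : Measurable fun t => G (t - a) := hG.comp (measurable_id.sub_const a)
    calc ∫⁻ t, G t = ∫⁻ t, G (t - a) := (lintegral_sub_right_eq_self G a).symm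
      _ = ∫⁻ t, G (t - a) ∂(ENNReal.ofReal |2| • Measure.map (fun t : ℝ => 2 * t) volume) := by
          rw [Real.smul_map_volume_mul_left two_ne_zero]
      _ = ENNReal.ofReal |2| * ∫⁻ t, G (2 * t - a) := by
          rw [lintegral_smul_measure, lintegral_map h2 (measurable_const_mul 2), smul_eq_mul]
  rw [h1, abs_of_pos two_pos, ENNReal.ofReal_ofNat, ← mul_assoc,
    ENNReal.inv_mul_cancel two_ne_zero (by simp), one_mul]

/-- Finiteness of `A` is essential: for `θ > 0` the hypothesis is vacuous at `A = ⊤`. -/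
theorem ENNReal.le_mul_of_le_mul_add {A B : ℝ≥0∞} {θ : ℝ} (hθ0 : 0 ≤ θ) (hθ : θ < 1) (hA : A ≠ ⊤)
    (h : A ≤ ENNReal.ofReal θ * A + B) : A ≤ ENNReal.ofReal (1 / (1 - θ)) * B := by
  have h1 : 0 < 1 - θ := by linarith
  obtain rfl | hB := eq_or_ne B ⊤
  · rw [ENNReal.mul_top]
    · exact le_top
    · rw [ENNReal.ofReal_ne_zero_iff]; positivity
  lift A to ℝ≥0 using hA
  lift B to ℝ≥0 using hB
  rw [← ENNReal.ofReal_coe_nnreal, ← ENNReal.ofReal_coe_nnreal (p := B),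
    ← ENNReal.ofReal_mul hθ0, ← ENNReal.ofReal_add (by positivity) (by positivity),
    ENNReal.ofReal_le_ofReal_iff (by positivity)] at h
  rw [← ENNReal.ofReal_coe_nnreal, ← ENNReal.ofReal_coe_nnreal (p := B),
    ← ENNReal.ofReal_mul (by positivity)]
  refine ENNReal.ofReal_le_ofReal ?_
  rw [one_div, inv_mul_eq_div, le_div_iff₀ h1]
  linarith

/-! ### Boundary collars and depth doubling. -/

section Chart

variable {n : ℕ} {Ω : Set (EuclideanSpace ℝ (Fin n))}
  (T : EuclideanSpace ℝ (Fin n) ≃ₗᵢ[ℝ] WithLp 2 (EuclideanSpace ℝ (Fin (n - 1)) × ℝ))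
  (φ : EuclideanSpace ℝ (Fin (n - 1)) → ℝ)

/-- The vertical distance from `y` down from the graph of `φ`. -/
noncomputable def depth (y : EuclideanSpace ℝ (Fin n)) : ℝ := φ (T y).fst - (T y).snd

/-- The points over the ball of radius `ε` about `a` at depth between `0` and `H`. -/
def collar (a : EuclideanSpace ℝ (Fin (n - 1))) (ε H : ℝ) : Set (EuclideanSpace ℝ (Fin n)) :=
  {y | dist (T y).fst a < ε ∧ 0 < depth T φ y ∧ depth T φ y < H}

theorem depth_sub_smul_vertDir (y : EuclideanSpace ℝ (Fin n)) (t : ℝ) :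
    depth T φ (y - t • vertDir T) = depth T φ y + t := by
  rw [depth, fst_sub_smul_vertDir, snd_sub_smul_vertDir, depth]
  ring

/-- For the nearest frontier point `z` to `y`, Hölder continuity bounds the depth by `K d^α + d`.
Conversely the graph point above `y` is outside `Ω`, so `d` is at most the depth. The first bound
reaches depth `2 * H` so that it covers segments to double depth. -/
theorem exists_collar {α : ℝ≥0} (hα0 : 0 < α) (hα1 : α ≤ 1) (hΩ : IsOpen Ω)
    (hfr : IsCompact (frontier Ω)) {ξ : EuclideanSpace ℝ (Fin n)} (hξ : ξ ∈ frontier Ω)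
    {U : Set (EuclideanSpace ℝ (Fin n))} (hU : IsOpen U) (hξU : ξ ∈ U) {K : ℝ≥0}
    (hφ : HolderWith K α φ) (hΩU : Ω ∩ U = {x | (T x).snd < φ (T x).fst} ∩ U) :
    ∃ ε > 0, ∃ H > 0, (∀ y, dist (T y).fst (T ξ).fst < ε → 0 < depth T φ y →
        depth T φ y < 2 * H → y ∈ Ω ∧ depth T φ y ≤ (K + 1) * bdryDist Ω y ^ (α : ℝ)) ∧
      (∀ y ∈ collar T φ (T ξ).fst ε H, bdryDist Ω y ≤ depth T φ y) ∧
      ∃ ρ > 0, Ω ∩ Metric.ball ξ ρ ⊆ collar T φ (T ξ).fst ε H := by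
  have hφc : Continuous φ := hφ.continuous hα0
  have hc1 := continuous_fst_coord T
  have hc2 := continuous_snd_coord T
  have hmem : ∀ x ∈ U, (x ∈ Ω ↔ (T x).snd < φ (T x).fst) := by
    intro x hx
    have h : x ∈ Ω ∩ U ↔ x ∈ {x | (T x).snd < φ (T x).fst} ∩ U := by rw [hΩU]
    constructor
    · exact fun hxΩ => (h.1 ⟨hxΩ, hx⟩).1
    · exact fun hxφ => (h.2 ⟨hxφ, hx⟩).1
  have hξΩ : ξ ∉ Ω := by
    rw [hΩ.frontier_eq] at hξ
    exact hξ.2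
  have hξφ : φ (T ξ).fst = (T ξ).snd := by
    refine le_antisymm (not_lt.1 fun h => hξΩ ((hmem ξ hξU).2 h)) (not_lt.1 fun h => ?_)
    have hV : IsOpen (U ∩ {x | φ (T x).fst < (T x).snd}) :=
      hU.inter (isOpen_lt (by fun_prop) (by fun_prop))
    obtain ⟨x, ⟨hxU, hxV⟩, hxΩ⟩ := mem_closure_iff.1 (frontier_subset_closure hξ) _ hV ⟨hξU, h⟩
    exact lt_asymm ((hmem x hxU).1 hxΩ) hxV
  obtain ⟨R', hR', hR'U⟩ := Metric.isOpen_iff.1 hU ξ hξU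
  obtain ⟨R, hR0, hR1, hRU⟩ : ∃ R > 0, R ≤ 1 ∧ Metric.ball ξ R ⊆ U :=
    ⟨min R' 1, by positivity, min_le_right _ _,
      (Metric.ball_subset_ball (min_le_left _ _)).trans hR'U⟩
  obtain ⟨ε', hε', hφε⟩ := Metric.continuous_iff.1 hφc (T ξ).fst (R / 32) (by positivity)
  obtain ⟨ε, hε, hεε, hεR⟩ : ∃ ε > 0, ε ≤ ε' ∧ ε ≤ R / 8 :=
    ⟨min ε' (R / 8), by positivity, min_le_left _ _, min_le_right _ _⟩
  have hnear : ∀ y, dist (T y).fst (T ξ).fst < ε → |depth T φ y| ≤ R / 8 → dist y ξ < R / 2 := by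
    intro y hy hd
    have h1 := hφε _ (hy.trans_le hεε)
    rw [Real.dist_eq] at h1
    have h2 : ‖T y - T ξ‖ ≤ ‖(T y - T ξ).fst‖ + ‖(T y - T ξ).snd‖ := by
      have h3 := WithLp.prod_norm_sq_eq_of_L2 (T y - T ξ)
      have h4 := norm_nonneg (T y - T ξ).fst
      have h5 := norm_nonneg (T y - T ξ).snd
      refine abs_le_of_sq_le_sq' ?_ (by positivity) |>.2
      nlinarith
    rw [WithLp.sub_fst, WithLp.sub_snd, ← dist_eq_norm, ← dist_eq_norm, T.dist_map, ← dist_eq_norm,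
      Real.dist_eq] at h2
    have h3 : |(T y).snd - (T ξ).snd| ≤ R / 32 + R / 8 := by
      have h4 : (T y).snd - (T ξ).snd = (φ (T y).fst - φ (T ξ).fst) - depth T φ y := by
        rw [depth, hξφ]; ring
      rw [h4]
      exact (abs_sub _ _).trans (by linarith)
    linarith
  refine ⟨ε, hε, R / 16, by positivity, fun y hy h0 h1 => ?_, fun y hy => ?_,
    min ε (R / 32), by positivity, ?_⟩
  · have hyξ := hnear y hy (by rw [abs_of_pos h0]; linarith)
    have hyU : y ∈ U := hRU (Metric.mem_ball.2 (by linarith))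
    have hyΩ : y ∈ Ω := (hmem y hyU).2 (by rw [depth] at h0; linarith)
    refine ⟨hyΩ, ?_⟩
    obtain ⟨z, hz, hyz⟩ := hfr.exists_infDist_eq_dist ⟨ξ, hξ⟩ y
    have hyz : bdryDist Ω y = dist y z := hyz
    have hdξ : bdryDist Ω y ≤ dist y ξ := Metric.infDist_le_dist_of_mem hξ
    have hd0 : 0 < bdryDist Ω y := bdryDist_pos hΩ ⟨ξ, hξ⟩ hyΩ
    have hzU : z ∈ U := by
      refine hRU (Metric.mem_ball.2 ?_)
      have := dist_triangle_left z ξ y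
      linarith
    have hzΩ : z ∉ Ω := by
      rw [hΩ.frontier_eq] at hz
      exact hz.2
    have hzφ : φ (T z).fst ≤ (T z).snd := not_lt.1 fun h => hzΩ ((hmem z hzU).2 h)
    have h2 := hφ.dist_le (T y).fst (T z).fst
    have h3 : dist (T y).fst (T z).fst ^ (α : ℝ) ≤ bdryDist Ω y ^ (α : ℝ) := by
      rw [hyz]
      exact Real.rpow_le_rpow dist_nonneg (dist_fst_coord_le T y z) α.2
    have h4 : (K : ℝ) * dist (T y).fst (T z).fst ^ (α : ℝ) ≤ K * bdryDist Ω y ^ (α : ℝ) := by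
      gcongr
    -- This uses `d ≤ 1`, the reason for choosing `R ≤ 1`.
    have h5 : bdryDist Ω y ≤ bdryDist Ω y ^ (α : ℝ) := by
      nth_rw 1 [← Real.rpow_one (bdryDist Ω y)]
      exact Real.rpow_le_rpow_of_exponent_ge hd0 (by linarith) (by exact_mod_cast hα1)
    have h6 := abs_snd_coord_sub_le T z y
    rw [dist_comm z y, ← hyz] at h6
    rw [Real.dist_eq] at h2
    rw [depth]
    linarith [le_abs_self (φ (T y).fst - φ (T z).fst), le_abs_self ((T z).snd - (T y).snd)]
  · obtain ⟨hy1, hy2, hy3⟩ := hy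
    by_contra! hlt
    -- The graph point vertically above `y`; if `d` exceeded the depth, it would lie in `Ω`.
    set z := y - (-depth T φ y) • vertDir T with hz
    have hzd : depth T φ z = 0 := by rw [hz, depth_sub_smul_vertDir]; ring
    have hz1 : dist (T z).fst (T ξ).fst < ε := by rw [hz, fst_sub_smul_vertDir]; exact hy1
    have hzξ := hnear z hz1 (by rw [hzd, abs_zero]; positivity)
    have hzU : z ∈ U := hRU (Metric.mem_ball.2 (by linarith))
    have hzΩ : z ∉ Ω := by
      rw [hmem z hzU]
      rw [depth] at hzd
      linarith
    have hyξ := hnear y hy1 (by rw [abs_of_pos hy2]; linarith)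
    have hyU : y ∈ U := hRU (Metric.mem_ball.2 (by linarith))
    have hyΩ : y ∈ Ω := (hmem y hyU).2 (by rw [depth] at hy2; linarith)
    refine hzΩ (ball_bdryDist_subset hyΩ le_rfl ?_)
    rw [Metric.mem_ball, hz, dist_eq_norm, sub_sub_cancel_left, norm_neg, norm_smul, norm_vertDir,
      norm_neg, Real.norm_eq_abs, abs_of_pos hy2, mul_one]
    exact hlt
  · rintro y ⟨hyΩ, hyξ⟩
    rw [Metric.mem_ball, lt_min_iff] at hyξ
    have hyU : y ∈ U := hRU (Metric.mem_ball.2 (by linarith))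
    have h1 : dist (T y).fst (T ξ).fst < ε := (dist_fst_coord_le T y ξ).trans_lt hyξ.1
    have h2 := hφε _ (h1.trans_le hεε)
    have h3 := abs_snd_coord_sub_le T y ξ
    have h4 := (hmem y hyU).1 hyΩ
    rw [Real.dist_eq] at h2
    refine ⟨h1, by rw [depth]; linarith, ?_⟩
    rw [depth]
    rw [abs_lt] at h2
    rw [abs_le] at h3
    linarith [h2.2, h3.1, hyξ.2]

variable {T φ}

theorem continuous_depth (hφ : Continuous φ) : Continuous (depth T φ) :=
  (hφ.comp (continuous_fst_coord T)).sub (continuous_snd_coord T)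

theorem isOpen_collar (hφ : Continuous φ) (a : EuclideanSpace ℝ (Fin (n - 1))) (ε H : ℝ) :
    IsOpen (collar T φ a ε H) := by
  have h1 := continuous_fst_coord T
  have h2 := continuous_depth (T := T) hφ
  have h3 : IsOpen {y | dist (T y).fst a < ε} := isOpen_lt (by fun_prop) (by fun_prop)
  have h4 : IsOpen {y | 0 < depth T φ y} := isOpen_lt (by fun_prop) (by fun_prop)
  have h5 : IsOpen {y | depth T φ y < H} := isOpen_lt (by fun_prop) (by fun_prop)
  exact h3.inter (h4.inter h5)

/-- On each vertical line the map is `t ↦ 2 * t - φ x'`, which doubles depth and has Jacobian 2.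
This factor `2⁻¹` drives the absorption near the boundary. -/
theorem setLIntegral_collar_comp_double (hφ : Continuous φ) (a : EuclideanSpace ℝ (Fin (n - 1)))
    (ε H : ℝ) {F : EuclideanSpace ℝ (Fin n) → ℝ≥0∞} (hF : Measurable F) :
    ∫⁻ y in collar T φ a ε H, F (y - depth T φ y • vertDir T) =
      2⁻¹ * ∫⁻ y in collar T φ a ε (2 * H), F y := by
  obtain ⟨c, -, hc⟩ := exists_lintegral_eq_lintegral_coord T
  have hm := fun H => (isOpen_collar (T := T) hφ a ε H).measurableSet
  have hd := continuous_depth (T := T) hφ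
  have hFd : Measurable fun y => F (y - depth T φ y • vertDir T) := by
    refine hF.comp (Continuous.measurable ?_)
    fun_prop
  rw [← lintegral_indicator (hm _), ← lintegral_indicator (hm _), hc _ (hFd.indicator (hm _)),
    hc _ (hF.indicator (hm _)), mul_left_comm]
  congr 1
  rw [← lintegral_const_mul' 2⁻¹ _ (by simp)]
  refine lintegral_congr fun x' => ?_
  set G : ℝ → ℝ≥0∞ := fun t => (collar T φ a ε (2 * H)).indicator F
    (T.symm (WithLp.toLp 2 (x', t))) with hG
  have hGm : Measurable G := by
    refine (hF.indicator (hm _)).comp (Continuous.measurable ?_)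
    exact T.symm.continuous.comp ((WithLp.prod_continuous_toLp 2 _ _).comp (by fun_prop))
  rw [← lintegral_comp_two_mul_sub G hGm (φ x')]
  refine lintegral_congr fun t => ?_
  set y := T.symm (WithLp.toLp 2 (x', t)) with hy
  have hyd : depth T φ y = φ x' - t := by simp [depth, hy]
  have hy' : y - depth T φ y • vertDir T = T.symm (WithLp.toLp 2 (x', 2 * t - φ x')) := by
    apply T.injective
    rw [LinearIsometryEquiv.apply_symm_apply, hyd]
    apply (WithLp.ofLp_injective 2)
    refine Prod.ext ?_ ?_
    · exact (fst_sub_smul_vertDir T _ _).trans (by simp [hy])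
    · refine (snd_sub_smul_vertDir T _ _).trans ?_
      simp [hy]
      ring
  have hiff : y ∈ collar T φ a ε H ↔ y - depth T φ y • vertDir T ∈ collar T φ a ε (2 * H) := by
    change (_ ∧ _ ∧ _) ↔ (_ ∧ _ ∧ _)
    rw [fst_sub_smul_vertDir, depth_sub_smul_vertDir]
    constructor
    · rintro ⟨h1, h2, h3⟩
      exact ⟨h1, by linarith, by linarith⟩
    · rintro ⟨h1, h2, h3⟩
      exact ⟨h1, by linarith, by linarith⟩
  change _ = (collar T φ a ε (2 * H)).indicator F (T.symm (WithLp.toLp 2 (x', 2 * t - φ x')))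
  rw [← hy']
  by_cases hmem : y ∈ collar T φ a ε H
  · rw [Set.indicator_of_mem hmem, Set.indicator_of_mem (hiff.1 hmem)]
  · rw [Set.indicator_of_notMem hmem, Set.indicator_of_notMem (fun h => hmem (hiff.2 h))]

end Chart

/-! ### Estimate of the averages near the boundary. -/

section Boundary

variable {n : ℕ} {Ω : Set (EuclideanSpace ℝ (Fin n))} {s p q b : ℝ}
  {T : EuclideanSpace ℝ (Fin n) ≃ₗᵢ[ℝ] WithLp 2 (EuclideanSpace ℝ (Fin (n - 1)) × ℝ)}
  {φ : EuclideanSpace ℝ (Fin (n - 1)) → ℝ}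

theorem exists_lintegral_collar_ballAvg_sub_double_le (hn : 1 ≤ n) (hs : 0 < s) (hp : 1 ≤ p)
    (hpq : p ≤ q) {α : ℝ} (hα0 : 0 ≤ α) (hα1 : α ≤ 1)
    (hb : b ≤ p * (s - n) + p * ((n : ℝ) - 1 + α) * (1 + 1 / q - 1 / p))
    (hΩ : IsOpen Ω) {M : ℝ} (hΩM : ∀ x ∈ Ω, 0 < bdryDist Ω x ∧ bdryDist Ω x ≤ M) (hM : 0 < M)
    (hφ : Continuous φ) {a : EuclideanSpace ℝ (Fin (n - 1))} {ε H K : ℝ} (hK : 0 < K)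
    (hcusp : ∀ y, dist (T y).fst a < ε → 0 < depth T φ y → depth T φ y < 2 * H →
      y ∈ Ω ∧ depth T φ y ≤ K * bdryDist Ω y ^ α)
    (hdepth : ∀ y ∈ collar T φ a ε H, bdryDist Ω y ≤ depth T φ y) :
    ∃ C : ℝ, 0 < C ∧ ∀ f : EuclideanSpace ℝ (Fin n) → ℝ, Measurable f → (∃ N, ∀ x, |f x| ≤ N) →
      ∫⁻ y in collar T φ a ε H,
        ‖ballAvg Ω f y - ballAvg Ω f (y - depth T φ y • vertDir T)‖ₑ ^ q ≤
      ENNReal.ofReal C * fracEnergy Ω s p b f ^ (q / p) := by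
  have hp0 : 0 < p := by linarith
  have hq0 : 0 < q := by linarith
  have hr : 1 ≤ q / p := (one_le_div hp0).2 hpq
  -- The exponent forced by the shadow volume; with it, `hb'` is exactly the assumed bound on `b`.
  set ν : ℝ := ((n : ℝ) - 1 + α) * p / q with hν
  have hνr : ν * (q / p) = n - 1 + α := by rw [hν]; field_simp
  have hb' : (p - 1) * (1 - α) - ν ≤ s * p - n - b := by
    have h1 : p * (s - n) + p * ((n : ℝ) - 1 + α) * (1 + 1 / q - 1 / p) =
        s * p - n - ((p - 1) * (1 - α) - ν) := by
      rw [hν]; field_simp; ring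
    linarith
  obtain ⟨C₁, hC₁, h1⟩ := exists_enorm_ballAvg_sub_rpow_le_lintegral_segment hs hp Ω
    (norm_vertDir T) hK hM hb'
  obtain ⟨C₂, hC₂, K', hK', h2⟩ := exists_lintegral_segment_le_lintegral_shadow T (ν := ν) hΩ hα1
    hα0 hK hM hΩM
  obtain ⟨C₃, hC₃, h3⟩ := exists_lintegral_shadow_rpow_le T hn hΩ hK' hr hνr
    fun x hx => (hΩM x hx).1
  refine ⟨(C₁ * C₂) ^ (q / p) * C₃, by positivity, fun f hf hN => ?_⟩
  set J : EuclideanSpace ℝ (Fin n) → ℝ≥0∞ := fun y => ∫⁻ x in Ω, energyDensity Ω s p b f x *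
    (shadow T Ω α K').indicator (fun z => ENNReal.ofReal (bdryDist Ω z.1 ^ (-ν))) (x, y) with hJ
  calc ∫⁻ y in collar T φ a ε H,
        ‖ballAvg Ω f y - ballAvg Ω f (y - depth T φ y • vertDir T)‖ₑ ^ q
      ≤ ∫⁻ y in collar T φ a ε H, ENNReal.ofReal ((C₁ * C₂) ^ (q / p)) * J y ^ (q / p) := by
        refine setLIntegral_mono' (isOpen_collar hφ a ε H).measurableSet fun y hy => ?_
        obtain ⟨hy1, hy2, hy3⟩ := hy
        have hseg : ∀ t ∈ Set.Icc 0 (depth T φ y), y - t • vertDir T ∈ Ω ∧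
            depth T φ y ≤ K * bdryDist Ω (y - t • vertDir T) ^ α := by
          intro t ht
          have h4 := hcusp (y - t • vertDir T)
          rw [fst_sub_smul_vertDir, depth_sub_smul_vertDir] at h4
          obtain ⟨h5, h6⟩ := h4 hy1 (by linarith [ht.1]) (by linarith [ht.2])
          exact ⟨h5, by linarith [ht.1]⟩
        have h4 := h1 f hf hN y (depth T φ y) hy2
          (by linarith [hdepth y ⟨hy1, hy2, hy3⟩]) fun t ht =>
            ⟨(hΩM _ (hseg t ht).1).1, (hΩM _ (hseg t ht).1).2, (hseg t ht).2⟩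
        have h5 := h4.trans (mul_le_mul_right
          (h2 _ (energyDensity_measurable hf) y (depth T φ y) hy2 hseg) _)
        rw [← mul_assoc, ← ENNReal.ofReal_mul hC₁.le] at h5
        rw [← ENNReal.ofReal_rpow_of_pos (by positivity), ← ENNReal.mul_rpow_of_nonneg _ _
          (by positivity)]
        refine le_trans (le_of_eq ?_) (ENNReal.rpow_le_rpow h5 (by positivity))
        rw [← ENNReal.rpow_mul, mul_div_cancel₀ _ hp0.ne']
    _ ≤ ∫⁻ y, ENNReal.ofReal ((C₁ * C₂) ^ (q / p)) * J y ^ (q / p) := setLIntegral_le_lintegral _ _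
    _ = ENNReal.ofReal ((C₁ * C₂) ^ (q / p)) * ∫⁻ y, J y ^ (q / p) :=
        lintegral_const_mul' _ _ ENNReal.ofReal_ne_top
    _ ≤ ENNReal.ofReal ((C₁ * C₂) ^ (q / p)) *
        (ENNReal.ofReal C₃ * fracEnergy Ω s p b f ^ (q / p)) := by
        gcongr
        exact h3 _ (energyDensity_measurable hf)
    _ = _ := by rw [← mul_assoc, ← ENNReal.ofReal_mul (by positivity)]

theorem exists_lintegral_ballAvg_sub_le_of_isCompact (hs : 0 < s) (hp : 1 ≤ p) (hq : 0 ≤ q)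
    (hΩ : IsOpen Ω) (hc : IsPreconnected Ω) (hfr : (frontier Ω).Nonempty)
    {x₀ : EuclideanSpace ℝ (Fin n)} (hx₀ : x₀ ∈ Ω) {A K : Set (EuclideanSpace ℝ (Fin n))}
    (hK : IsCompact K) (hKΩ : K ⊆ Ω) (hA : MeasurableSet A) (hAK : A ⊆ K) :
    ∃ C : ℝ≥0, ∀ f : EuclideanSpace ℝ (Fin n) → ℝ, Measurable f → (∃ N, ∀ x, |f x| ≤ N) →
      ∫⁻ x in A, ‖ballAvg Ω f x - ballAvg Ω f x₀‖ₑ ^ q ≤ C * fracEnergy Ω s p b f ^ (q / p) := by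
  obtain ⟨C, hC⟩ := exists_ballAvg_sub_le_of_isCompact (b := b) hs hp hΩ hc hfr hx₀ hK hKΩ
  have hAtop : volume A ≠ ⊤ := (measure_mono hAK).trans_lt hK.measure_lt_top |>.ne
  refine ⟨C ^ q * (volume A).toNNReal, fun f hf hN => ?_⟩
  calc ∫⁻ x in A, ‖ballAvg Ω f x - ballAvg Ω f x₀‖ₑ ^ q
      ≤ ∫⁻ x in A, (C * fracEnergy Ω s p b f ^ (1 / p)) ^ q :=
        setLIntegral_mono' hA fun x hx => ENNReal.rpow_le_rpow (hC f hf hN x (hAK hx)) hq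
    _ = _ := by
        rw [setLIntegral_const, ENNReal.mul_rpow_of_nonneg _ _ hq, ← ENNReal.rpow_mul,
          ENNReal.coe_mul, ENNReal.coe_toNNReal hAtop, ENNReal.coe_rpow_of_nonneg _ hq,
          one_div_mul_eq_div, mul_right_comm]

/-- Let `A` be the norm of `u - c` on the collar. The norm at doubled points is `2^(-1/q)` times the
norm on the collar of height `2 * H`, hence at most `2^(-1/q) A` plus a contribution from depth at
least `H`, which is bounded away from the boundary. `A` is finite since `f` is bounded, so it can be
absorbed. -/
theorem exists_lintegral_collar_ballAvg_sub_le (hn : 1 ≤ n) (hs : 0 < s) (hp : 1 ≤ p)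
    (hpq : p ≤ q) {α : ℝ} (hα0 : 0 < α) (hα1 : α ≤ 1)
    (hb : b ≤ p * (s - n) + p * ((n : ℝ) - 1 + α) * (1 + 1 / q - 1 / p))
    (hΩ : IsOpen Ω) (hc : IsPreconnected Ω) (hfr : (frontier Ω).Nonempty)
    (hbd : Bornology.IsBounded Ω) {x₀ : EuclideanSpace ℝ (Fin n)} (hx₀ : x₀ ∈ Ω)
    {M : ℝ} (hΩM : ∀ x ∈ Ω, 0 < bdryDist Ω x ∧ bdryDist Ω x ≤ M) (hM : 0 < M)
    (hφ : Continuous φ) {a : EuclideanSpace ℝ (Fin (n - 1))} {ε H K : ℝ} (hH : 0 < H) (hK : 0 < K)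
    (hcusp : ∀ y, dist (T y).fst a < ε → 0 < depth T φ y → depth T φ y < 2 * H →
      y ∈ Ω ∧ depth T φ y ≤ K * bdryDist Ω y ^ α)
    (hdepth : ∀ y ∈ collar T φ a ε H, bdryDist Ω y ≤ depth T φ y) :
    ∃ C : ℝ≥0, ∀ f : EuclideanSpace ℝ (Fin n) → ℝ, Measurable f → (∃ N, ∀ x, |f x| ≤ N) →
      ∫⁻ x in collar T φ a ε H, ‖ballAvg Ω f x - ballAvg Ω f x₀‖ₑ ^ q ≤
        C * fracEnergy Ω s p b f ^ (q / p) := by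
  have hp0 : 0 < p := by linarith
  have hq0 : 0 < q := by linarith
  obtain ⟨C₁, hC₁, h1⟩ := exists_lintegral_collar_ballAvg_sub_double_le hn hs hp hpq hα0.le hα1 hb
    hΩ hΩM hM hφ hK hcusp hdepth
  have hm := fun H => (isOpen_collar (T := T) hφ a ε H).measurableSet
  have hsub : ∀ H' ≤ 2 * H, collar T φ a ε H' ⊆ Ω := fun H' hH' y hy =>
    (hcusp y hy.1 hy.2.1 (hy.2.2.trans_le hH')).1
  -- Depth at least `H` and `depth ≤ K d^α` force `d ≥ ρ`.
  set ρ := (H / K) ^ (1 / α) with hρ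
  have hρ0 : 0 < ρ := by positivity
  obtain ⟨C₂, h2⟩ := exists_lintegral_ballAvg_sub_le_of_isCompact (b := b) hs hp hq0.le hΩ hc hfr hx₀
    (A := collar T φ a ε (2 * H) \ collar T φ a ε H) (K := closure Ω ∩ {x | ρ ≤ bdryDist Ω x})
    (hbd.isCompact_closure.inter_right
      (isClosed_le continuous_const (continuous_bdryDist Ω))) (by
      rintro x ⟨hx, hxρ⟩
      have hxρ : ρ ≤ bdryDist Ω x := hxρ
      by_contra hxΩ
      have hxf : x ∈ frontier Ω := by rw [hΩ.frontier_eq]; exact ⟨hx, hxΩ⟩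
      have : bdryDist Ω x = 0 := Metric.infDist_zero_of_mem hxf
      linarith) ((hm _).diff (hm _)) (by
      rintro x ⟨hx, hxH⟩
      have hxΩ := hsub _ le_rfl hx
      refine ⟨subset_closure hxΩ, ?_⟩
      have hHx : H ≤ depth T φ x := by
        by_contra! hlt
        exact hxH ⟨hx.1, hx.2.1, hlt⟩
      have h3 := (hcusp x hx.1 hx.2.1 hx.2.2).2
      have h4 : H / K ≤ bdryDist Ω x ^ α := by
        rw [div_le_iff₀ hK]; linarith
      have hd := (hΩM x hxΩ).1
      change ρ ≤ bdryDist Ω x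
      calc ρ ≤ (bdryDist Ω x ^ α) ^ (1 / α) := Real.rpow_le_rpow (by positivity) h4 (by positivity)
        _ = bdryDist Ω x := by
          rw [← Real.rpow_mul hd.le, mul_one_div_cancel hα0.ne', Real.rpow_one])
  set θ : ℝ := 2⁻¹ ^ (1 / q) with hθ
  have hθ0 : 0 ≤ θ := by positivity
  have hθ1 : θ < 1 := Real.rpow_lt_one (by norm_num) (by norm_num) (by positivity)
  set D : ℝ := 1 / (1 - θ) with hD
  have hD0 : 0 < D := by
    have : 0 < 1 - θ := by linarith
    positivity
  refine ⟨(D.toNNReal * (C₁.toNNReal ^ (1 / q) + C₂ ^ (1 / q))) ^ q, fun f hf hN => ?_⟩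
  set c := ballAvg Ω f x₀ with hcdef
  set A := (∫⁻ x in collar T φ a ε H, ‖ballAvg Ω f x - c‖ₑ ^ q) ^ (1 / q) with hA
  set E := fracEnergy Ω s p b f with hE
  have hum : Measurable (ballAvg Ω f) := ballAvg_measurable hf
  have hdc := continuous_depth (T := T) hφ
  have hudm : Measurable fun y => ballAvg Ω f (y - depth T φ y • vertDir T) :=
    hum.comp (Continuous.measurable (by fun_prop))
  have hEq : (E ^ (q / p)) ^ (1 / q) = E ^ (1 / p) := by
    rw [← ENNReal.rpow_mul]
    congr 1
    field_simp
  have hAtop : A ≠ ⊤ := by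
    obtain ⟨N, hN⟩ := hN
    refine (ENNReal.rpow_lt_top_of_nonneg (by positivity) (lintegral_enorm_rpow_lt_top
      (N := N + |c|) ?_ (fun x hx => ?_) (hm _) hq0.le).ne).ne
    · exact ((measure_mono (hsub H (by linarith))).trans_lt hbd.measure_lt_top).ne
    · have := abs_ballAvg_le hN (hΩM x (hsub H (by linarith) hx)).1
      exact (abs_sub _ _).trans (by linarith)
  have hAq : ∫⁻ x in collar T φ a ε H, ‖ballAvg Ω f x - c‖ₑ ^ q = A ^ q := by
    rw [hA, ← ENNReal.rpow_mul, one_div_mul_cancel hq0.ne', ENNReal.rpow_one]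
  have hdouble : (∫⁻ y in collar T φ a ε H,
      ‖ballAvg Ω f (y - depth T φ y • vertDir T) - c‖ₑ ^ q) ^ (1 / q) ≤
      ENNReal.ofReal θ * A + (C₂ : ℝ≥0∞) ^ (1 / q) * E ^ (1 / p) := by
    rw [setLIntegral_collar_comp_double hφ a ε H (F := fun y => ‖ballAvg Ω f y - c‖ₑ ^ q)
      ((hum.sub measurable_const).enorm.pow_const q),
      ENNReal.mul_rpow_of_nonneg _ _ (by positivity)]
    have h3 : (2⁻¹ : ℝ≥0∞) ^ (1 / q) = ENNReal.ofReal θ := by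
      rw [hθ, ← ENNReal.ofReal_rpow_of_pos (by norm_num), ENNReal.ofReal_inv_of_pos two_pos,
        ENNReal.ofReal_ofNat]
    have h4 : ∫⁻ y in collar T φ a ε (2 * H), ‖ballAvg Ω f y - c‖ₑ ^ q ≤
        A ^ q + C₂ * E ^ (q / p) := by
      rw [← Set.union_sdiff_cancel (show collar T φ a ε H ⊆ collar T φ a ε (2 * H) from
        fun y hy => ⟨hy.1, hy.2.1, by linarith [hy.2.2]⟩)]
      refine (lintegral_union_le _ _ _).trans (add_le_add hAq.le (h2 f hf hN))
    have h5 : (∫⁻ y in collar T φ a ε (2 * H), ‖ballAvg Ω f y - c‖ₑ ^ q) ^ (1 / q) ≤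
        A + (C₂ : ℝ≥0∞) ^ (1 / q) * E ^ (1 / p) := by
      refine (ENNReal.rpow_le_rpow h4 (by positivity)).trans ?_
      refine (ENNReal.rpow_add_le_add_rpow _ _ (by positivity)
        ((div_le_one hq0).2 (by linarith))).trans (le_of_eq ?_)
      rw [← ENNReal.rpow_mul, mul_one_div_cancel hq0.ne', ENNReal.rpow_one,
        ENNReal.mul_rpow_of_nonneg _ _ (by positivity), hEq]
    rw [h3]
    refine (mul_le_mul_right h5 _).trans ?_
    rw [mul_add]
    have h6 : ENNReal.ofReal θ ≤ 1 := by
      rw [← ENNReal.ofReal_one]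
      exact ENNReal.ofReal_le_ofReal hθ1.le
    refine add_le_add le_rfl ?_
    calc _ ≤ 1 * ((C₂ : ℝ≥0∞) ^ (1 / q) * E ^ (1 / p)) := by gcongr
      _ = _ := one_mul _
  have hmain : A ≤ ENNReal.ofReal θ * A +
      (ENNReal.ofReal C₁ ^ (1 / q) + (C₂ : ℝ≥0∞) ^ (1 / q)) * E ^ (1 / p) := by
    refine (lintegral_enorm_sub_rpow_le_add hum hudm measurable_const (by linarith)).trans ?_
    have h3 := ENNReal.rpow_le_rpow (h1 f hf hN) (show 0 ≤ 1 / q by positivity)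
    rw [ENNReal.mul_rpow_of_nonneg _ _ (by positivity), hEq] at h3
    refine (add_le_add h3 hdouble).trans (le_of_eq ?_)
    ring
  have hfin := ENNReal.le_mul_of_le_mul_add hθ0 hθ1 hAtop hmain
  rw [hAq]
  refine (ENNReal.rpow_le_rpow hfin hq0.le).trans (le_of_eq ?_)
  rw [← mul_assoc, ENNReal.mul_rpow_of_nonneg _ _ hq0.le, ← ENNReal.rpow_mul, one_div_mul_eq_div,
    ENNReal.coe_rpow_of_nonneg _ hq0.le, ENNReal.coe_mul, ENNReal.coe_add,
    ENNReal.coe_rpow_of_nonneg _ (by positivity), ENNReal.coe_rpow_of_nonneg _ (by positivity)]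
  rfl

end Boundary

/-! ### Assembly of the theorem. -/

theorem mainTheorem8 (n : ℕ) (hn : 2 ≤ n) (α : ℝ≥0) (hα0 : 0 < α) (hα1 : α ≤ 1)
    (Ω : Set (EuclideanSpace ℝ (Fin n))) (hΩ : IsHolderDomain α Ω)
    (s p q b : ℝ) (hs0 : 0 < s) (hs1 : s < 1) (hp : 1 < p) (hpq : p ≤ q)
    (hb : b ≤ p * (s - n) + p * ((n : ℝ) - 1 + α) * (1 + 1 / q - 1 / p))
    (hq : p < n / s → q ≤ n * p / (n - s * p)) :
    ∃ C : ℝ, 0 < C ∧ ∀ f : EuclideanSpace ℝ (Fin n) → ℝ, ContDiffOn ℝ ∞ f Ω →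
      (⨅ c : ℝ, eLpNorm (fun y => f y - c) (ENNReal.ofReal q) (volume.restrict Ω)) ≤
        ENNReal.ofReal C * fracEnergy Ω s p b f ^ (1 / p) := by
  have : NeZero n := ⟨by omega⟩
  have hp0 : 0 < p := by linarith
  have hq0 : 0 < q := by linarith
  have hnR : (2 : ℝ) ≤ n := by exact_mod_cast hn
  have hαR1 : (α : ℝ) ≤ 1 := by exact_mod_cast hα1
  have hαR0 : (0 : ℝ) < α := by exact_mod_cast hα0
  obtain ⟨hΩo, hΩc, hΩb, hΩchart⟩ := hΩ
  have hfr : (frontier Ω).Nonempty := frontier_nonempty_of_isBounded hΩc.nonempty hΩb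
  obtain ⟨x₀, hx₀⟩ := hΩc.nonempty
  have hvol : volume Ω ≠ ⊤ := hΩb.measure_lt_top.ne
  have hfrc : IsCompact (frontier Ω) :=
    hΩb.isCompact_closure.of_isClosed_subset isClosed_frontier frontier_subset_closure
  obtain ⟨M, hM0, hΩM⟩ : ∃ M, 0 < M ∧ ∀ x ∈ Ω, 0 < bdryDist Ω x ∧ bdryDist Ω x ≤ M := by
    obtain ⟨ξ, hξ⟩ := hfr
    refine ⟨Metric.diam (closure Ω) + 1, by have := Metric.diam_nonneg (s := closure Ω); linarith,
      fun x hx => ⟨bdryDist_pos hΩo ⟨ξ, hξ⟩ hx, ?_⟩⟩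
    have h1 : bdryDist Ω x ≤ dist x ξ := Metric.infDist_le_dist_of_mem hξ
    have h2 := Metric.dist_le_diam_of_mem hΩb.closure (subset_closure hx)
      (frontier_subset_closure hξ)
    linarith
  have hκ : 0 ≤ s * p - n + n * p / q := by
    obtain h | h := lt_or_ge p (n / s)
    · have h1 := hq h
      rw [lt_div_iff₀ hs0] at h
      rw [le_div_iff₀ (by linarith)] at h1
      have h2 : (n : ℝ) - s * p ≤ n * p / q := by
        rw [le_div_iff₀ hq0]; linarith
      linarith
    · rw [div_le_iff₀ hs0] at h
      have : 0 ≤ (n : ℝ) * p / q := by positivity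
      linarith
  -- The right-hand side exceeds the assumed bound on `b` by `p (1 - α)(1 + 1/q - 1/p)`, which is
  -- nonnegative.
  have hσ : b ≤ s * p - n + n * p / q := by
    have h1 : s * p - n + n * p / q - (p * (s - n) + p * ((n : ℝ) - 1 + α) * (1 + 1 / q - 1 / p)) =
        p * (1 - α) * (1 + 1 / q - 1 / p) := by
      field_simp; ring
    have h2 : 0 ≤ 1 + 1 / q - 1 / p := by
      have h3 : 1 / p ≤ 1 := (div_le_one hp0).2 hp.le
      have h4 : 0 < 1 / q := by positivity
      linarith
    have h3 : 0 ≤ p * (1 - α) * (1 + 1 / q - 1 / p) :=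
      mul_nonneg (mul_nonneg hp0.le (by linarith)) h2
    linarith
  have H : ∃ K : ℝ≥0, ∀ f : EuclideanSpace ℝ (Fin n) → ℝ, Measurable f → (∃ N, ∀ x, |f x| ≤ N) →
      ∫⁻ x in closure Ω ∩ Ω, ‖ballAvg Ω f x - ballAvg Ω f x₀‖ₑ ^ q ≤
        K * fracEnergy Ω s p b f ^ (q / p) := by
    -- The estimate passes to subsets and finite unions, so by compactness of the closure it
    -- suffices to find one neighbourhood of each point: a closed ball inside `Ω`, or a collar.
    refine hΩb.isCompact_closure.induction_on (p := fun S => ∃ K : ℝ≥0,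
      ∀ f : EuclideanSpace ℝ (Fin n) → ℝ, Measurable f → (∃ N, ∀ x, |f x| ≤ N) →
      ∫⁻ x in S ∩ Ω, ‖ballAvg Ω f x - ballAvg Ω f x₀‖ₑ ^ q ≤
        K * fracEnergy Ω s p b f ^ (q / p)) ⟨0, fun f _ _ => by simp⟩ ?_ ?_ ?_
    · rintro S S' hSS' ⟨K, hK⟩
      exact ⟨K, fun f hf hN => (lintegral_mono_set (Set.inter_subset_inter_left _ hSS')).trans
        (hK f hf hN)⟩
    · rintro S S' ⟨K, hK⟩ ⟨K', hK'⟩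
      refine ⟨K + K', fun f hf hN => ?_⟩
      rw [Set.union_inter_distrib_right, ENNReal.coe_add, add_mul]
      exact (lintegral_union_le _ _ _).trans (add_le_add (hK f hf hN) (hK' f hf hN))
    · intro ξ hξ
      by_cases hξΩ : ξ ∈ Ω
      · have hd := (hΩM ξ hξΩ).1
        obtain ⟨C, hC⟩ := exists_lintegral_ballAvg_sub_le_of_isCompact (b := b) (A :=
          Metric.closedBall ξ (bdryDist Ω ξ / 2)) hs0 hp.le hq0.le hΩo
          hΩc.isPreconnected hfr hx₀ (isCompact_closedBall ξ (bdryDist Ω ξ / 2))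
          ((Metric.closedBall_subset_ball (by linarith)).trans (ball_bdryDist_subset hξΩ le_rfl))
          Metric.isClosed_closedBall.measurableSet subset_rfl
        exact ⟨_, mem_nhdsWithin_of_mem_nhds (Metric.closedBall_mem_nhds ξ (half_pos hd)), C,
          fun f hf hN => (lintegral_mono_set Set.inter_subset_left).trans (hC f hf hN)⟩
      · have hξf : ξ ∈ frontier Ω := by rw [hΩo.frontier_eq]; exact ⟨hξ, hξΩ⟩
        obtain ⟨U, hU, hξU, T, φ, K, hφ, hΩU⟩ := hΩchart ξ hξf
        obtain ⟨ε, hε, H, hH, hcusp, hdepth, ρ, hρ, hsub⟩ := exists_collar T φ hα0 hα1 hΩo hfrc hξf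
          hU hξU hφ hΩU
        obtain ⟨C, hC⟩ := exists_lintegral_collar_ballAvg_sub_le (by omega) hs0 hp.le hpq hαR0 hαR1
          hb hΩo hΩc.isPreconnected hfr hΩb hx₀ hΩM hM0 (hφ.continuous hα0) hH (by positivity)
          hcusp hdepth
        refine ⟨_, mem_nhdsWithin_of_mem_nhds (Metric.ball_mem_nhds ξ hρ), C, fun f hf hN =>
          (lintegral_mono_set ?_).trans (hC f hf hN)⟩
        rw [Set.inter_comm]
        exact hsub
  rw [Set.inter_eq_right.2 subset_closure] at H
  obtain ⟨C, hC, h⟩ := exists_iInf_eLpNorm_le hp.le hq0 hΩo hfr hx₀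
    (exists_lintegral_sub_ballAvg_le hs0 hp.le hpq hκ hσ hΩo hfr hvol (fun x hx => (hΩM x hx).2)
      hx₀ H)
  exact ⟨C, hC, fun f hf => h f hf.continuousOn⟩
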